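/- Let $(W,S)$ be a Coxeter system with $S$ finite and let $\mathbb{K}$ be a noetherian integral domain. Let $V$ be a free $\mathbb{K}$-module of finite rank with a $\mathbb{K}$-linear action of $W$, and let $\alpha_s\in V$ and $\alpha_s^\vee\in V^*=\operatorname{Hom}_{\mathbb{K}}(V,\mathbb{K})$ ($s\in S$) be such that, for all $s\in S$ and $v\in V$: $\langle\alpha_s^\vee,\alpha_s\rangle=2$; $s(v)=v-\langle\alpha_s^\vee,v\rangle\alpha_s$; $\alpha_s^\vee\colon V\to\mathbb{K}$ is surjective; and $\alpha_s\neq0$. Let $R=S(V)$ be the symmetric algebra, graded by $\deg V=2$, with the induced action of $W$, and let $Q$ be the fraction field of $R$. For every reflection $t\in W$ fix a presentation $t=wsw^{-1}$ with $w\in W$, $s\in S$, and put $\alpha_t^\vee=w(\alpha_s^\vee)$. Let $\mathcal{C}$ be the category whose objects are the graded $R$-bimodules $M$, finitely generated as bimodules and flat as right $R$-modules, together with a decomposition $M\otimes_RQ=\bigoplus_{w\in W}M_Q^w$ into $(R,Q)$-sub-bimodules such that $M_Q^w\ne0$ for only finitely many $w$ and $mf=w(f)m$ for all $m\in M_Q^w$,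 $f\in R$. Morphisms are the degree-zero bimodule homomorphisms $M\to N$ sending $M_Q^w$ to $N_Q^w$ for every $w$. The tensor product in $\mathcal{C}$ is $M\otimes_RN$ with $(M\otimes N)_Q^w=\bigoplus_{xy=w}M_Q^x\otimes_QN_Q^y$. For $s\in S$ let $R^s=\{f\in R\mid s(f)=f\}$ and $B_s=R\otimes_{R^s}R(1)\in\mathcal{C}$, where $M(1)^i=M^{i+1}$ and the decomposition of $B_s\otimes_R Q$ is the unique one with $(B_s)_Q^w=0$ for $w\notin\{e,s\}$. For $\underline{x}=(s_1,\dots,s_l)\in S^l$ put $B_{\underline{x}}=B_{s_1}\otimes\cdots\otimes B_{s_l}$ and $u_{\underline{x}}=(1\otimes1)\otimes\cdots\otimes(1\otimes1)\in B_{\underline{x}}$. Suppose that for all $s,t\in S$ such that $st$ has finite order and for all distinct reflections $t_1\neq t_2$ in the subgroup $\langle s,t\rangle$ of $W$ there exists $v\in V$ with $\langle v,\alpha_{t_1}^\vee\rangle=0$ and $\langle v,\alpha_{t_2}^\vee\rangle=1$. Then for all $s\neq t$ in $S$ such that the order $m$ of $st$ is finite, with $\underline{x}=(s,t,s,\dots)\in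 S^m$ and $\underline{y}=(t,s,t,\dots)\in S^m$, there exists a morphism $B_{\underline{x}}\to B_{\underline{y}}$ in $\mathcal{C}$ (so of degree zero) which sends $u_{\underline{x}}$ to $u_{\underline{y}}$. -/

import Mathlib

open TensorProduct CategoryTheory

universe u v w x

set_option linter.unusedSectionVars false
set_option linter.unusedVariables false

namespace Soergel

noncomputable section

section SymmetricAlgebra

variable (K : Type u) [CommRing K] (V : Type v) [AddCommGroup V] [Module K V]

/-- The degree `n` part of `S(V)`, where `V` has degree `2`. -/
def symGrade (n : ℤ) : Submodule K (SymmetricAlgebra K V) :=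
  Submodule.span K
    {f | ∃ l : List V, 2 * (l.length : ℤ) = n ∧ f = (l.map (SymmetricAlgebra.ι K V)).prod}

variable {K V} {W : Type x} [Group W]

/-- The action of `W` on `S(V)` by algebra endomorphisms which extends the action on `V`. -/
def symAct (ρ : Representation K W V) :
    W →* (SymmetricAlgebra K V →ₐ[K] SymmetricAlgebra K V) where
  toFun g := SymmetricAlgebra.lift (SymmetricAlgebra.ι K V ∘ₗ ρ g)
  map_one' := by
    apply SymmetricAlgebra.algHom_ext
    ext v
    simp
  map_mul' g h := by
    apply SymmetricAlgebra.algHom_ext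
    ext v
    simp

end SymmetricAlgebra

section Bimodules

variable (K : Type u) [CommRing K] (R : Type w) [CommRing R] [Algebra K R]

/-- An `R`-bimodule on which `K` acts centrally. As `R` is commutative, the right action is also
given by an algebra homomorphism. -/
structure Bimod where
  carrier : Type w
  [addCommGroup : AddCommGroup carrier]
  [module : Module K carrier]
  left : R →ₐ[K] Module.End K carrier
  right : R →ₐ[K] Module.End K carrier
  left_right : ∀ a b m, left a (right b m) = right b (left a m)

attribute [instance] Bimod.addCommGroup Bimod.module

variable {K R}

/-- The underlying left `R`-module of a bimodule. -/
def Bimod.Left (M : Bimod K R) : Type w := M.carrier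

/-- The underlying right `R`-module of a bimodule (written as a module over the commutative
ring `R`). -/
def Bimod.Right (M : Bimod K R) : Type w := M.carrier

namespace Bimod

variable (M N : Bimod K R)

instance : AddCommGroup M.Left := M.addCommGroup
instance : Module K M.Left := M.module
instance : Module R M.Left := Module.compHom M.carrier M.left.toRingHom
instance : AddCommGroup M.Right := M.addCommGroup
instance : Module K M.Right := M.module
instance : Module R M.Right := Module.compHom M.carrier M.right.toRingHom

instance : IsScalarTower K R M.Left where
  smul_assoc k a m := by
    change M.left (k • a) m = k • M.left a m
    rw [map_smul]; rfl

instance : IsScalarTower K R M.Right where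
  smul_assoc k a m := by
    change M.right (k • a) m = k • M.right a m
    rw [map_smul]; rfl

/-- The left multiplications, as endomorphisms of the right module `M`. -/
def leftMul : R →ₐ[K] Module.End R M.Right where
  toFun a :=
    { toFun := M.left a
      map_add' := (M.left a).map_add
      map_smul' := fun b m ↦ M.left_right a b m }
  map_one' := LinearMap.ext fun m ↦ LinearMap.congr_fun (map_one M.left) m
  map_mul' a b := LinearMap.ext fun m ↦ LinearMap.congr_fun (map_mul M.left a b) m
  map_zero' := LinearMap.ext fun m ↦ LinearMap.congr_fun (map_zero M.left) m
  map_add' a b := LinearMap.ext fun m ↦ LinearMap.congr_fun (map_add M.left a b) m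
  commutes' k := LinearMap.ext fun m ↦ LinearMap.congr_fun (M.left.commutes k) m

/-- The right multiplications, as endomorphisms of the left module `M`. -/
def rightMul : R →ₐ[K] Module.End R M.Left where
  toFun a :=
    { toFun := M.right a
      map_add' := (M.right a).map_add
      map_smul' := fun b m ↦ (M.left_right b a m).symm }
  map_one' := LinearMap.ext fun m ↦ LinearMap.congr_fun (map_one M.right) m
  map_mul' a b := LinearMap.ext fun m ↦ LinearMap.congr_fun (map_mul M.right a b) m
  map_zero' := LinearMap.ext fun m ↦ LinearMap.congr_fun (map_zero M.right) m
  map_add' a b := LinearMap.ext fun m ↦ LinearMap.congr_fun (map_add M.right a b) m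
  commutes' k := LinearMap.ext fun m ↦ LinearMap.congr_fun (M.right.commutes k) m

/-- The bimodule attached to a commutative algebra with two homomorphisms from `R`. -/
def ofAlgHom {A : Type w} [CommRing A] [Algebra K A] (l r : R →ₐ[K] A) : Bimod K R where
  carrier := A
  left := (Algebra.lmul K A).comp l
  right := (Algebra.lmul K A).comp r
  left_right a b m := mul_left_comm (l a) (r b) m

/-- The tensor product `M ⊗_R N` of bimodules. -/
def tensor : Bimod K R where
  carrier := M.Right ⊗[R] N.Left
  left :=
    { toFun := fun a ↦ ((M.leftMul a).rTensor N.Left).restrictScalars K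
      map_one' := by rw [map_one, Module.End.one_eq_id, LinearMap.rTensor_id]; rfl
      map_mul' := fun a b ↦ by rw [map_mul, LinearMap.rTensor_mul]; rfl
      map_zero' := by rw [map_zero, LinearMap.rTensor_zero]; rfl
      map_add' := fun a b ↦ by rw [map_add, LinearMap.rTensor_add]; rfl
      commutes' := fun k ↦ by
        ext t
        induction t with
        | zero => simp
        | tmul m n => exact congrArg (· ⊗ₜ[R] n) (LinearMap.congr_fun (M.leftMul.commutes k) m)
        | add s t hs ht => simp only [map_add, hs, ht] }
  right :=
    { toFun := fun a ↦ ((N.rightMul a).lTensor M.Right).restrictScalars K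
      map_one' := by rw [map_one, Module.End.one_eq_id, LinearMap.lTensor_id]; rfl
      map_mul' := fun a b ↦ by rw [map_mul, LinearMap.lTensor_mul]; rfl
      map_zero' := by rw [map_zero, LinearMap.lTensor_zero]; rfl
      map_add' := fun a b ↦ by rw [map_add, LinearMap.lTensor_add]; rfl
      commutes' := fun k ↦ by
        ext t
        induction t with
        | zero => simp
        | tmul m n =>
          exact (congrArg (m ⊗ₜ[R] ·) (LinearMap.congr_fun (N.rightMul.commutes k) n)).trans
            (tmul_smul k m n)
        | add s t hs ht => simp only [map_add, hs, ht] }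
  left_right a b t := by
    induction t with
    | zero => simp
    | tmul m n => rfl
    | add s t hs ht => simp only [map_add, hs, ht]

/-- `M_Q = M ⊗_R Q` (as `R` is commutative, we write the factor `Q` first). -/
abbrev loc : Type w := FractionRing R ⊗[R] M.Right

/-- The natural map `M → M_Q`. -/
def toLoc : M.Right →ₗ[R] M.loc := TensorProduct.mk R (FractionRing R) M.Right 1

/-- The left action of `a` on `M_Q`. -/
def leftLoc (a : R) : M.loc →ₗ[FractionRing R] M.loc := (M.leftMul a).baseChange (FractionRing R)

/-- A homomorphism of `R`-bimodules. -/
structure Hom where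
  toLin : M.carrier →ₗ[K] N.carrier
  map_left : ∀ a m, toLin (M.left a m) = N.left a (toLin m)
  map_right : ∀ a m, toLin (M.right a m) = N.right a (toLin m)

variable {M N}

/-- A homomorphism of bimodules, as a homomorphism of right modules. -/
def Hom.onRight (φ : M.Hom N) : M.Right →ₗ[R] N.Right where
  toFun := φ.toLin
  map_add' := φ.toLin.map_add
  map_smul' := φ.map_right

/-- The map `M_Q → N_Q` induced by a homomorphism `M → N`. -/
def Hom.onLoc (φ : M.Hom N) : M.loc →ₗ[FractionRing R] N.loc :=
  φ.onRight.baseChange (FractionRing R)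

end Bimod

end Bimodules

section Category

variable {K : Type u} [CommRing K] {R : Type w} [CommRing R] [Algebra K R]
variable {W : Type x} [Group W]

variable (K R W) in
/-- A bimodule `M` together with a family of subspaces `M ^ i` of `M`, indexed by integers, and a
family of subspaces `M_Q ^ g` of `M_Q`, indexed by `W`. The laws are in `IsCPrime` and `IsC`. -/
structure DecBimod extends Bimod K R where
  grade : ℤ → Submodule K carrier
  stalk : W → Submodule (FractionRing R) toBimod.loc

namespace DecBimod

/-- `M` is an object of the category `C'`: it is a graded bimodule over the graded ring `R`
(with homogeneous parts `𝒢 i`), and `M_Q` is the direct sum of the `M_Q ^ g`, which are nonzero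
only for finitely many `g`, and on which `m f = g(f) m`, where `g(f)` is `σ g f`. -/
structure IsCPrime (σ : W →* (R →ₐ[K] R)) (𝒢 : ℤ → Submodule K R) (M : DecBimod K R W) :
    Prop where
  grade_indep : iSupIndep M.grade
  grade_iSup : ⨆ i, M.grade i = ⊤
  left_mem : ∀ i j a m, a ∈ 𝒢 i → m ∈ M.grade j → M.left a m ∈ M.grade (i + j)
  right_mem : ∀ i j a m, a ∈ 𝒢 i → m ∈ M.grade j → M.right a m ∈ M.grade (j + i)
  stalk_indep : iSupIndep M.stalk
  stalk_iSup : ⨆ g, M.stalk g = ⊤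
  stalk_finite : {g | M.stalk g ≠ ⊥}.Finite
  stalk_smul : ∀ g f, ∀ z ∈ M.stalk g,
    algebraMap R (FractionRing R) f • z = M.leftLoc (σ g f) z

/-- `M` is an object of the category `C`: it is an object of `C'` which is finitely generated as an
`R`-bimodule and flat as a right `R`-module. -/
structure IsC (σ : W →* (R →ₐ[K] R)) (𝒢 : ℤ → Submodule K R) (M : DecBimod K R W) : Prop
    extends IsCPrime σ 𝒢 M where
  finitelyGenerated : ∃ F : Finset M.carrier, ∀ N : AddSubgroup M.carrier, (F : Set M.carrier) ⊆ N →
    (∀ a, ∀ m ∈ N, M.left a m ∈ N) → (∀ a, ∀ m ∈ N, M.right a m ∈ N) → N = ⊤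
  flat : Module.Flat R M.Right

/-- A morphism of `C'` (and of its full subcategory `C`): a homomorphism of bimodules which has
degree zero and sends `M_Q ^ g` to `N_Q ^ g` for every `g`. -/
structure Hom (M N : DecBimod K R W) extends Bimod.Hom M.toBimod N.toBimod where
  map_grade : ∀ i, ∀ m ∈ M.grade i, toLin m ∈ N.grade i
  map_stalk : ∀ g, ∀ z ∈ M.stalk g, toHom.onLoc z ∈ N.stalk g

/-- `M_g`, the inverse image of `M_Q ^ g` in `M`. -/
def sub (M : DecBimod K R W) (g : W) : Submodule R M.Right :=
  ((M.stalk g).restrictScalars R).comap M.toLoc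

/-- The tensor product in `C`: the bimodule `M ⊗_R N` with `(M ⊗ N)_Q ^ g` the sum of the
`M_Q ^ x ⊗_Q N_Q ^ y` over `x y = g`. As every element of `M_Q ^ x` is of the form `m q⁻¹` with
`m ∈ M_x` and `q ∈ R`, and similarly for `N`, the subspace `M_Q ^ x ⊗_Q N_Q ^ y` of `(M ⊗ N)_Q` is
the `Q`-span of the tensors `m ⊗ n` with `m ∈ M_x` and `n ∈ N_y`. -/
def tensor (M N : DecBimod K R W) : DecBimod K R W where
  toBimod := M.toBimod.tensor N.toBimod
  grade n := Submodule.span K {t : M.Right ⊗[R] N.Left | ∃ i j : ℤ, ∃ m : M.Right, ∃ m' : N.Left,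
    m ∈ M.grade i ∧ m' ∈ N.grade j ∧ i + j = n ∧ t = m ⊗ₜ[R] m'}
  stalk g := ⨆ p : {p : W × W // p.1 * p.2 = g},
    Submodule.span (FractionRing R) {z | ∃ m ∈ M.sub p.1.1, ∃ m' ∈ N.sub p.1.2,
      z = (M.toBimod.tensor N.toBimod).toLoc (m ⊗ₜ[R] m' : M.Right ⊗[R] N.Left)}

variable (W) in
/-- The unit object `R_e` of the tensor product. -/
def unit (𝒢 : ℤ → Submodule K R) : DecBimod K R W where
  toBimod := Bimod.ofAlgHom (AlgHom.id K R) (AlgHom.id K R)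
  grade := 𝒢
  stalk g := ⨆ _ : g = 1, ⊤

end DecBimod

/-- The subspace of those `z` in `M_Q` such that `z f = h(f) z` for all `f` in `R`. -/
def Bimod.eigen (M : Bimod K R) (h : R →ₐ[K] R) : Submodule (FractionRing R) M.loc where
  carrier := {z | ∀ f, algebraMap R (FractionRing R) f • z = M.leftLoc (h f) z}
  add_mem' {y z} hy hz f := by rw [smul_add, hy f, hz f, map_add]
  zero_mem' f := by simp
  smul_mem' q z hz f := by rw [smul_comm, hz f, map_smul]

/-- The subalgebra `R ^ h` of elements fixed by `h`. -/
abbrev fixed (h : R →ₐ[K] R) : Subalgebra K R := AlgHom.equalizer h (AlgHom.id K R)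

/-- The object `B_s = R ⊗_{R ^ s} R (1)`. The decomposition of `(B_s)_Q` is the one with support
`{e, s}`. -/
def Bs (σ : W →* (R →ₐ[K] R)) (𝒢 : ℤ → Submodule K R) (s : W) : DecBimod K R W where
  toBimod := Bimod.ofAlgHom
    (Algebra.TensorProduct.includeLeft : R →ₐ[K] R ⊗[fixed (σ s)] R)
    ((Algebra.TensorProduct.includeRight : R →ₐ[fixed (σ s)] R ⊗[fixed (σ s)] R).restrictScalars K)
  grade n := Submodule.span K {t : R ⊗[fixed (σ s)] R | ∃ i j : ℤ, ∃ f ∈ 𝒢 i, ∃ g ∈ 𝒢 j,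
    i + j = n + 1 ∧ t = f ⊗ₜ[fixed (σ s)] g}
  stalk g := ⨆ _ : g = 1 ∨ g = s, Bimod.eigen _ (σ g)

/-- The objects of the category `C`. -/
structure ObjC (σ : W →* (R →ₐ[K] R)) (𝒢 : ℤ → Submodule K R) extends DecBimod K R W where
  isC : toDecBimod.IsC σ 𝒢

theorem DecBimod.Hom.ext' {M N : DecBimod K R W} {φ ψ : M.Hom N} (h : φ.toLin = ψ.toLin) :
    φ = ψ := by
  obtain ⟨⟨f, _, _⟩, _, _⟩ := φ
  obtain ⟨⟨g, _, _⟩, _, _⟩ := ψ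
  obtain rfl : f = g := h
  rfl

instance ObjC.category (σ : W →* (R →ₐ[K] R)) (𝒢 : ℤ → Submodule K R) :
    CategoryTheory.Category (ObjC σ 𝒢) where
  Hom M N := M.toDecBimod.Hom N.toDecBimod
  id M :=
    { toLin := LinearMap.id
      map_left := fun _ _ ↦ rfl
      map_right := fun _ _ ↦ rfl
      map_grade := fun _ _ h ↦ h
      map_stalk := fun g z h ↦ by
        change (LinearMap.id : M.Right →ₗ[R] M.Right).baseChange (FractionRing R) z ∈ M.stalk g
        rwa [LinearMap.baseChange_id] }
  comp {L M N} φ ψ :=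
    { toLin := ψ.toLin ∘ₗ φ.toLin
      map_left := fun a m ↦ by simp [φ.map_left, ψ.map_left]
      map_right := fun a m ↦ by simp [φ.map_right, ψ.map_right]
      map_grade := fun i m h ↦ ψ.map_grade i _ (φ.map_grade i m h)
      map_stalk := fun g z h ↦ by
        change (ψ.onRight ∘ₗ φ.onRight).baseChange (FractionRing R) z ∈ N.stalk g
        rw [LinearMap.baseChange_comp]
        exact ψ.map_stalk g _ (φ.map_stalk g z h) }

/-- The underlying map of a morphism of `C`. -/
def ObjC.toLin {σ : W →* (R →ₐ[K] R)} {𝒢 : ℤ → Submodule K R} {M N : ObjC σ 𝒢} (φ : M ⟶ N) :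
    M.carrier →ₗ[K] N.carrier :=
  (show M.toDecBimod.Hom N.toDecBimod from φ).toLin

end Category

/-! Helper facts: `B_s ⊗ M` is an object of `C` if `M` is. -/

section Helpers

variable {K : Type u} [CommRing K] {R : Type w} [CommRing R] [Algebra K R]
variable {W : Type x} [Group W]

/-- Coordinates with respect to a basis `1, δ` of `R` over `R ^ h`. -/
structure SplitData (h : R →ₐ[K] R) (𝒢 : ℤ → Submodule K R) where
  δ : R
  c : R →ₗ[fixed h] R
  d : R →ₗ[fixed h] R
  c_mem : ∀ f, c f ∈ fixed h
  d_mem : ∀ f, d f ∈ fixed h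
  eq_add : ∀ f, f = c f + δ * d f
  c_one : c 1 = 1
  d_one : d 1 = 0
  c_δ : c δ = 0
  d_δ : d δ = 1
  invol : ∀ f, h (h f) = f
  δ_mem : δ ∈ 𝒢 2
  c_grade : ∀ i, ∀ f ∈ 𝒢 i, c f ∈ 𝒢 i
  d_grade : ∀ i, ∀ f ∈ 𝒢 (i + 1), d f ∈ 𝒢 (i - 1)
  ne_zero : δ - h δ ≠ 0

namespace SplitData

variable {σ : W →* (R →ₐ[K] R)} {𝒢 : ℤ → Submodule K R} {s : W} (D : SplitData (σ s) 𝒢)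

/-- The `R`-linear extension of a coordinate. -/
def ext (c : R →ₗ[fixed (σ s)] R) : (Bs σ 𝒢 s).Right →ₗ[R] R where
  toFun := (LinearMap.mul' (fixed (σ s)) R ∘ₗ c.rTensor R : R ⊗[fixed (σ s)] R →ₗ[fixed (σ s)] R)
  map_add' := map_add _
  map_smul' b m := by
    change R ⊗[fixed (σ s)] R at m
    change (LinearMap.mul' (fixed (σ s)) R ∘ₗ c.rTensor R) ((1 : R) ⊗ₜ[fixed (σ s)] b * m) =
      b * (LinearMap.mul' (fixed (σ s)) R ∘ₗ c.rTensor R) m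
    induction m with
    | zero => simp
    | tmul f g => simp; ring
    | add x y hx hy => rw [mul_add, map_add, map_add, hx, hy, mul_add]

variable (M : DecBimod K R W)

/-- The coordinate `B_s ⊗ M → M`. -/
def coord (c : R →ₗ[fixed (σ s)] R) : ((Bs σ 𝒢 s).tensor M).Right →ₗ[R] M.Right where
  toFun := ((TensorProduct.lid R M.Left).toLinearMap ∘ₗ (ext (𝒢 := 𝒢) c).rTensor M.Left :
    (Bs σ 𝒢 s).Right ⊗[R] M.Left →ₗ[R] M.Left)
  map_add' := map_add _
  map_smul' b t := by
    change (Bs σ 𝒢 s).Right ⊗[R] M.Left at t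
    change ((TensorProduct.lid R M.Left).toLinearMap ∘ₗ (ext (𝒢 := 𝒢) c).rTensor M.Left)
      ((M.rightMul b).lTensor (Bs σ 𝒢 s).Right t) = M.rightMul b
      (((TensorProduct.lid R M.Left).toLinearMap ∘ₗ (ext (𝒢 := 𝒢) c).rTensor M.Left) t)
    induction t with
    | zero => simp
    | tmul f g => simp
    | add x y hx hy => simp only [map_add, hx, hy]

/-- The tensor `f ⊗ g` in `B_s`. -/
def bt (f g : R) : (Bs σ 𝒢 s).Right := (f ⊗ₜ[fixed (σ s)] g : R ⊗[fixed (σ s)] R)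

/-- The tensor `(f ⊗ g) ⊗ m` in `B_s ⊗ M`. -/
def tm (f g : R) (m : M.Right) : ((Bs σ 𝒢 s).tensor M).Right :=
  (bt f g ⊗ₜ[R] m : (Bs σ 𝒢 s).Right ⊗[R] M.Left)

theorem coord_tm (c : R →ₗ[fixed (σ s)] R) (f g : R) (m : M.Right) :
    coord M c (tm (𝒢 := 𝒢) M f g m) = M.leftMul (c f * g) m := rfl

theorem tm_ind {P : ((Bs σ 𝒢 s).tensor M).Right → Prop} (h0 : P 0)
    (hadd : ∀ x y, P x → P y → P (x + y)) (ht : ∀ f g m, P (tm M f g m)) : ∀ t, P t := by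
  intro t
  change (Bs σ 𝒢 s).Right ⊗[R] M.Left at t
  induction t with
  | zero => exact h0
  | add x y hx hy => exact hadd _ _ hx hy
  | tmul b m =>
    change R ⊗[fixed (σ s)] R at b
    induction b with
    | zero =>
      have := TensorProduct.zero_tmul (R := R) (Bs σ 𝒢 s).Right m
      exact this ▸ h0
    | add x y hx hy =>
      have := TensorProduct.add_tmul (R := R) (show (Bs σ 𝒢 s).Right from x) y m
      exact this ▸ hadd _ _ hx hy
    | tmul f g => exact ht f g m

theorem tm_mul (f g : R) (m : M.Right) :
    tm (σ := σ) (𝒢 := 𝒢) (s := s) M f g m = tm M f 1 (M.leftMul g m) := by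
  have : bt (σ := σ) (𝒢 := 𝒢) (s := s) f g = g • bt f 1 := by
    change f ⊗ₜ[fixed (σ s)] g = (1 : R) ⊗ₜ[fixed (σ s)] g * f ⊗ₜ[fixed (σ s)] (1 : R)
    simp
  unfold tm
  rw [this]
  exact TensorProduct.smul_tmul g _ _

theorem tm_fixed (f g k : R) (hk : k ∈ fixed (σ s)) (m : M.Right) :
    tm (σ := σ) (𝒢 := 𝒢) (s := s) M (f * k) g m = tm M f (k * g) m := by
  have := TensorProduct.smul_tmul (R := fixed (σ s)) (⟨k, hk⟩ : fixed (σ s)) f g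
  have h2 : bt (σ := σ) (𝒢 := 𝒢) (s := s) (f * k) g = bt f (k * g) := by
    rw [mul_comm f k]; exact this
  unfold tm
  rw [h2]

theorem tm_add (f f' g : R) (m : M.Right) :
    tm (σ := σ) (𝒢 := 𝒢) (s := s) M (f + f') g m = tm M f g m + tm M f' g m := by
  have : bt (σ := σ) (𝒢 := 𝒢) (s := s) (f + f') g = bt f g + bt f' g :=
    TensorProduct.add_tmul f f' g
  unfold tm
  rw [this]
  exact TensorProduct.add_tmul _ _ _

theorem tm_zero (f g : R) : tm (σ := σ) (𝒢 := 𝒢) (s := s) M f g 0 = 0 :=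
  TensorProduct.tmul_zero _ _

theorem tm_add_right (f g : R) (m m' : M.Right) :
    tm (σ := σ) (𝒢 := 𝒢) (s := s) M f g (m + m') = tm M f g m + tm M f g m' :=
  tmul_add _ _ _

theorem tm_smul (f g a : R) (m : M.Right) :
    tm (σ := σ) (𝒢 := 𝒢) (s := s) M f g (a • m) = a • tm M f g m := rfl

/-- `B_s ⊗ M` is the sum of two copies of `M`, as a right module. -/
def equiv : ((Bs σ 𝒢 s).tensor M).Right ≃ₗ[R] M.Right × M.Right where
  toLinearMap := (coord M D.c).prod (coord M D.d)
  invFun p := tm M 1 1 p.1 + tm M D.δ 1 p.2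
  left_inv t := by
    refine tm_ind (P := fun t ↦ tm M 1 1 (coord M D.c t) + tm M D.δ 1 (coord M D.d t) = t) M ?_ ?_ ?_ t
    · rw [map_zero, map_zero]
      exact (congrArg₂ (· + ·) (tm_zero M 1 1) (tm_zero M D.δ 1)).trans (add_zero 0)
    · intro x y hx hy
      rw [map_add, map_add, tm_add_right, tm_add_right]
      nth_rw 3 [← hx]; nth_rw 3 [← hy]
      abel
    · intro f g m
      rw [coord_tm, coord_tm, ← tm_mul, ← tm_mul, ← tm_fixed M 1 g _ (D.c_mem f),
        ← tm_fixed M _ g _ (D.d_mem f), ← tm_add, one_mul, ← D.eq_add]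
  right_inv p := by
    obtain ⟨m, m'⟩ := p
    simp [coord_tm, D.c_one, D.d_one, D.c_δ, D.d_δ]

end SplitData

theorem iSupIndep_prod {ι S M N : Type*} [Ring S] [AddCommGroup M] [AddCommGroup N] [Module S M]
    [Module S N] {A : ι → Submodule S M} {B : ι → Submodule S N} (hA : iSupIndep A)
    (hB : iSupIndep B) : iSupIndep fun i ↦ (A i).prod (B i) := by
  intro i
  rw [Submodule.disjoint_def]
  rintro ⟨m, n⟩ ⟨hm, hn⟩ h
  have : ⨆ j, ⨆ _ : j ≠ i, (A j).prod (B j) ≤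
      (⨆ j, ⨆ _ : j ≠ i, A j).prod (⨆ j, ⨆ _ : j ≠ i, B j) :=
    iSup₂_le fun j hj ↦ Submodule.prod_mono (le_iSup₂_of_le j hj le_rfl) (le_iSup₂_of_le j hj le_rfl)
  obtain ⟨h1, h2⟩ := this h
  exact Prod.ext ((Submodule.disjoint_def.1 (hA i)) m hm h1)
    ((Submodule.disjoint_def.1 (hB i)) n hn h2)

theorem iSup_prod_eq_top {ι S M N : Type*} [Ring S] [AddCommGroup M] [AddCommGroup N] [Module S M]
    [Module S N] {A : ι → Submodule S M} {B : ι → Submodule S N} (hA : ⨆ i, A i = ⊤)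
    (hB : ⨆ i, B i = ⊤) : ⨆ i, (A i).prod (B i) = ⊤ := by
  rw [eq_top_iff]
  rintro ⟨m, n⟩ -
  have h1 : ⊤ ≤ (⨆ i, (A i).prod (B i)).comap (LinearMap.inl S M N) := by
    rw [← hA]
    exact iSup_le fun i m hm ↦ Submodule.mem_iSup_of_mem (p := fun i ↦ (A i).prod (B i)) i
      ⟨hm, (B i).zero_mem⟩
  have h2 : ⊤ ≤ (⨆ i, (A i).prod (B i)).comap (LinearMap.inr S M N) := by
    rw [← hB]
    exact iSup_le fun i m hm ↦ Submodule.mem_iSup_of_mem (p := fun i ↦ (A i).prod (B i)) i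
      ⟨(A i).zero_mem, hm⟩
  have h3 : LinearMap.inl S M N m ∈ ⨆ i, (A i).prod (B i) := h1 Submodule.mem_top
  have h4 : LinearMap.inr S M N n ∈ ⨆ i, (A i).prod (B i) := h2 Submodule.mem_top
  simpa using add_mem h3 h4

theorem iSupIndep_comap {ι S M N : Type*} [Ring S] [AddCommGroup M] [AddCommGroup N] [Module S M]
    [Module S N] (e : M ≃ₗ[S] N) {A : ι → Submodule S N} (hA : iSupIndep A) :
    iSupIndep fun i ↦ (A i).comap e.toLinearMap :=
  hA.map_orderIso (Submodule.orderIsoMapComap e).symm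

theorem iSup_comap_eq_top {ι S M N : Type*} [Ring S] [AddCommGroup M] [AddCommGroup N] [Module S M]
    [Module S N] (e : M ≃ₗ[S] N) {A : ι → Submodule S N} (hA : ⨆ i, A i = ⊤) :
    ⨆ i, (A i).comap e.toLinearMap = ⊤ := by
  have := congrArg (Submodule.orderIsoMapComap e).symm hA
  rw [OrderIso.map_iSup, OrderIso.map_top] at this
  exact this

theorem iSupIndep.eq_zero {ι S M : Type*} [Ring S] [AddCommGroup M] [Module S M]
    {A : ι → Submodule S M} (hA : iSupIndep A) (hA' : ⨆ i, A i = ⊤) (T : M →ₗ[S] M)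
    (h1 : ∀ i, ∀ m ∈ A i, T m ∈ A i) (h2 : ∀ i, ∀ m ∈ A i, T m = 0 → m = 0) (m : M)
    (hm : T m = 0) : m = 0 := by
  obtain ⟨f, hf, rfl⟩ := (Submodule.mem_iSup_iff_exists_finsupp A m).1 (hA' ▸ Submodule.mem_top)
  rw [Finsupp.sum, map_sum] at hm
  refine Finset.sum_eq_zero fun i hi ↦ h2 i _ (hf i) ?_
  exact (iSupIndep_iff_finsetSum_eq_zero_imp_eq_zero A).1 hA f.support _ (fun i _ ↦ h1 i _ (hf i)) hm i hi

theorem flat_prod {S M : Type*} [CommRing S] [AddCommGroup M] [Module S M] [Module.Flat S M] :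
    Module.Flat S (M × M) :=
  .of_linearEquiv ((DirectSum.linearEquivFunOnFintype S (Fin 2) (fun _ ↦ M)).trans
    (LinearEquiv.finTwoArrow S M)).symm

theorem Bimod.exists_smul_toLoc [IsDomain R] (M : Bimod K R) (z : M.loc) :
    ∃ q : FractionRing R, ∃ r : R, ∃ n : M.Right, z = q • M.toLoc n ∧ r • z = M.toLoc n := by
  obtain ⟨⟨n, r⟩, h⟩ := IsLocalizedModule.surj (nonZeroDivisors R)
    (TensorProduct.mk R (FractionRing R) M.Right 1) z
  refine ⟨IsLocalization.mk' _ 1 r, r, n, ?_, h⟩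
  change z = _ • (TensorProduct.mk R (FractionRing R) M.Right 1) n
  rw [← h]
  change z = IsLocalization.mk' (FractionRing R) 1 r • (r : R) • z
  rw [← algebraMap_smul (FractionRing R) (r : R) z, smul_smul, IsLocalization.mk'_spec, map_one,
    one_smul]

theorem Bimod.leftLoc_toLoc (M : Bimod K R) (a : R) (m : M.Right) :
    M.leftLoc a (M.toLoc m) = M.toLoc (M.leftMul a m) := rfl

theorem Bimod.leftLoc_mul (M : Bimod K R) (a b : R) (z : M.loc) :
    M.leftLoc (a * b) z = M.leftLoc a (M.leftLoc b z) := by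
  unfold leftLoc
  rw [map_mul, Module.End.mul_eq_comp, LinearMap.baseChange_comp]
  rfl

theorem Bimod.leftLoc_add (M : Bimod K R) (a b : R) (z : M.loc) :
    M.leftLoc (a + b) z = M.leftLoc a z + M.leftLoc b z := by
  unfold leftLoc
  rw [map_add, LinearMap.baseChange_add]
  rfl

theorem Bimod.leftLoc_neg (M : Bimod K R) (a : R) (z : M.loc) :
    M.leftLoc (-a) z = -M.leftLoc a z := by
  unfold leftLoc
  rw [map_neg, LinearMap.baseChange_neg]
  rfl

theorem toLoc_injective [IsDomain R] (M : Bimod K R) [Module.Flat R M.Right] :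
    Function.Injective M.toLoc :=
  Module.Flat.tensorProduct_mk_injective (R := R) (S := FractionRing R) (M := M.Right)

namespace DecBimod
variable {σ : W →* (R →ₐ[K] R)} {𝒢 : ℤ → Submodule K R} {M : DecBimod K R W}

theorem IsCPrime.left_eq (hM : M.IsCPrime σ 𝒢) (g : W) (f : R) {z : M.loc} (hz : z ∈ M.stalk g) :
    M.leftLoc f z = σ g⁻¹ f • z := by
  have := hM.stalk_smul g (σ g⁻¹ f) z hz
  rw [algebraMap_smul] at this
  rw [this, ← AlgHom.mul_apply, ← map_mul, mul_inv_cancel, map_one, AlgHom.one_apply]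

theorem σ_inj (g : W) {f : R} (h : σ g f = 0) : f = 0 := by
  have : σ g⁻¹ (σ g f) = 0 := by rw [h, map_zero]
  rwa [← AlgHom.mul_apply, ← map_mul, inv_mul_cancel, map_one, AlgHom.one_apply] at this

theorem IsCPrime.left_mem_stalk (hM : M.IsCPrime σ 𝒢) (g : W) (f : R) {z : M.loc}
    (hz : z ∈ M.stalk g) : M.leftLoc f z ∈ M.stalk g := by
  rw [hM.left_eq g f hz, ← algebraMap_smul (FractionRing R)]
  exact Submodule.smul_mem _ _ hz

theorem smul_loc_eq_zero [IsDomain R] {a : R} (ha : a ≠ 0) {z : M.loc} (hz : a • z = 0) :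
    z = 0 := by
  rw [← algebraMap_smul (FractionRing R)] at hz
  refine (smul_eq_zero.1 hz).resolve_left ?_
  simpa using ha

theorem IsCPrime.left_injective [IsDomain R] (hM : M.IsCPrime σ 𝒢) {a : R} (ha : a ≠ 0) (z : M.loc)
    (hz : M.leftLoc a z = 0) : z = 0 := by
  refine iSupIndep.eq_zero hM.stalk_indep hM.stalk_iSup (M.leftLoc a)
    (fun g m hm ↦ hM.left_mem_stalk g a hm) (fun g m hm h ↦ ?_) z hz
  rw [hM.left_eq g a hm] at h
  exact smul_loc_eq_zero (fun h ↦ ha (σ_inj _ h)) h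

theorem IsCPrime.left_surjective [IsDomain R] (hM : M.IsCPrime σ 𝒢) {a : R} (ha : a ≠ 0) :
    Function.Surjective (M.leftLoc a) := by
  rw [← LinearMap.range_eq_top, eq_top_iff, ← hM.stalk_iSup]
  refine iSup_le fun g z hz ↦ ⟨(algebraMap R (FractionRing R) (σ g⁻¹ a))⁻¹ • z, ?_⟩
  rw [map_smul, hM.left_eq g a hz, ← algebraMap_smul (FractionRing R) (σ g⁻¹ a) z, smul_smul,
    inv_mul_cancel₀, one_smul]
  simpa using fun h ↦ ha (σ_inj _ h)

end DecBimod

namespace SplitData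

variable {σ : W →* (R →ₐ[K] R)} {𝒢 : ℤ → Submodule K R} {s : W} (D : SplitData (σ s) 𝒢)
variable (M : DecBimod K R W)

theorem trace_mem : D.δ + σ s D.δ ∈ fixed (σ s) := by
  change σ s _ = _
  rw [map_add, D.invol, add_comm]; rfl

theorem norm_mem : D.δ * σ s D.δ ∈ fixed (σ s) := by
  change σ s _ = _
  rw [map_mul, D.invol, mul_comm]; rfl

theorem map_mul_fixed (c : R →ₗ[fixed (σ s)] R) {k : R} (hk : k ∈ fixed (σ s)) (f : R) :
    c (k * f) = k * c f := c.map_smul (⟨k, hk⟩ : fixed (σ s)) f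

theorem coord_mul (c : R →ₗ[fixed (σ s)] R) (f : R) :
    c (D.δ * f) = D.c f * c D.δ + D.d f * ((D.δ + σ s D.δ) * c D.δ - D.δ * σ s D.δ * c 1) := by
  have h : D.δ * f = D.c f * D.δ + D.d f * ((D.δ + σ s D.δ) * D.δ)
      - D.d f * (D.δ * σ s D.δ * 1) := by
    linear_combination D.δ * D.eq_add f
  rw [h, map_sub, map_add, map_mul_fixed c (D.c_mem f), map_mul_fixed c (D.d_mem f),
    map_mul_fixed c (D.d_mem f), map_mul_fixed c D.trace_mem, map_mul_fixed c D.norm_mem]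
  ring

theorem ext_bt (c : R →ₗ[fixed (σ s)] R) (f g : R) :
    ext (𝒢 := 𝒢) c (bt f g) = c f * g := rfl

theorem bt_ind {P : (Bs σ 𝒢 s).Right → Prop} (h0 : P 0)
    (hadd : ∀ x y, P x → P y → P (x + y)) (ht : ∀ f g, P (bt f g)) : ∀ t, P t := by
  intro b
  change R ⊗[fixed (σ s)] R at b
  induction b with
  | zero => exact h0
  | add x y hx hy => exact hadd _ _ hx hy
  | tmul f g => exact ht f g

theorem left_bt (a f g : R) :
    (Bs σ 𝒢 s).leftMul a (bt f g) = bt (a * f) g := by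
  change (a ⊗ₜ[fixed (σ s)] (1 : R)) * f ⊗ₜ[fixed (σ s)] g = (a * f) ⊗ₜ[fixed (σ s)] g
  simp

theorem right_bt (a f g : R) :
    a • (bt f g : (Bs σ 𝒢 s).Right) = bt f (a * g) := by
  change ((1 : R) ⊗ₜ[fixed (σ s)] a) * f ⊗ₜ[fixed (σ s)] g = f ⊗ₜ[fixed (σ s)] (a * g)
  simp

theorem ext_d_left (b : (Bs σ 𝒢 s).Right) :
    ext D.d ((Bs σ 𝒢 s).leftMul D.δ b) = ext D.c b + (D.δ + σ s D.δ) * ext D.d b := by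
  refine bt_ind (P := fun b ↦ ext D.d ((Bs σ 𝒢 s).leftMul D.δ b) =
    ext D.c b + (D.δ + σ s D.δ) * ext D.d b) ?_ ?_ ?_ b
  · simp
  · intro x y hx hy
    rw [map_add, map_add, map_add, map_add, hx, hy]; ring
  · intro f g
    rw [left_bt, ext_bt, ext_bt, ext_bt, D.coord_mul D.d, D.d_δ, D.d_one]
    ring

theorem left_fixed {k : R} (hk : k ∈ fixed (σ s)) (b : (Bs σ 𝒢 s).Right) :
    (Bs σ 𝒢 s).leftMul k b = k • b := by
  refine bt_ind (P := fun b ↦ (Bs σ 𝒢 s).leftMul k b = k • b) ?_ ?_ ?_ b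
  · simp
  · intro x y hx hy
    rw [map_add, hx, hy, smul_add]
  · intro f g
    rw [left_bt, right_bt]
    exact TensorProduct.smul_tmul (R := fixed (σ s)) (⟨k, hk⟩ : fixed (σ s)) f g

theorem bt_fixed (f g k : R) (hk : k ∈ fixed (σ s)) :
    (bt (f * k) g : (Bs σ 𝒢 s).Right) = bt f (k * g) := by
  rw [mul_comm f k]
  exact TensorProduct.smul_tmul (R := fixed (σ s)) (⟨k, hk⟩ : fixed (σ s)) f g

theorem bt_zero (f : R) : (bt f 0 : (Bs σ 𝒢 s).Right) = 0 := TensorProduct.tmul_zero _ _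

theorem bt_eq (b : (Bs σ 𝒢 s).Right) : b = bt 1 (ext D.c b) + bt D.δ (ext D.d b) := by
  refine bt_ind (P := fun b ↦ b = bt 1 (ext D.c b) + bt D.δ (ext D.d b)) ?_ ?_ ?_ b
  · simp only [map_zero, bt_zero, add_zero]
  · intro x y hx hy
    have h (f g g' : R) : (bt f (g + g') : (Bs σ 𝒢 s).Right) = bt f g + bt f g' :=
      TensorProduct.tmul_add _ _ _
    rw [map_add, map_add, h, h]
    nth_rw 1 [hx]; nth_rw 1 [hy]
    abel
  · intro f g
    have h (f f' g : R) : (bt (f + f') g : (Bs σ 𝒢 s).Right) = bt f g + bt f' g :=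
      TensorProduct.add_tmul _ _ _
    rw [ext_bt, ext_bt, ← bt_fixed 1 g _ (D.c_mem f), ← bt_fixed _ g _ (D.d_mem f), ← h, one_mul,
      ← D.eq_add]

theorem Bs_toLoc_inj (D : SplitData (σ s) 𝒢) [IsDomain R] {b b' : (Bs σ 𝒢 s).Right}
    (h : (Bs σ 𝒢 s).toLoc b = (Bs σ 𝒢 s).toLoc b') : b = b' := by
  have key (c : R →ₗ[fixed (σ s)] R) : ext (𝒢 := 𝒢) c b = ext (𝒢 := 𝒢) c b' := by
    have := congrArg ((ext (𝒢 := 𝒢) c).baseChange (FractionRing R)) h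
    have h2 := congrArg (TensorProduct.rid R (FractionRing R)) this
    change (TensorProduct.rid R (FractionRing R)) ((1 : FractionRing R) ⊗ₜ[R] ext (𝒢 := 𝒢) c b) =
      (TensorProduct.rid R (FractionRing R)) ((1 : FractionRing R) ⊗ₜ[R] ext (𝒢 := 𝒢) c b') at h2
    rw [TensorProduct.rid_tmul, TensorProduct.rid_tmul, Algebra.smul_def, Algebra.smul_def, mul_one,
      mul_one] at h2
    exact IsFractionRing.injective R (FractionRing R) h2
  rw [D.bt_eq b, D.bt_eq b', key, key]

theorem mem_Bs_sub (D : SplitData (σ s) 𝒢) [IsDomain R] (g : W) (b : (Bs σ 𝒢 s).Right) :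
    b ∈ (Bs σ 𝒢 s).sub g ↔
      (b = 0 ∨ ((g = 1 ∨ g = s) ∧ ∀ f, f • b = (Bs σ 𝒢 s).leftMul (σ g f) b)) := by
  change (Bs σ 𝒢 s).toLoc b ∈ (⨆ _ : g = 1 ∨ g = s, Bimod.eigen _ (σ g)) ↔ _
  by_cases h : g = 1 ∨ g = s
  · rw [iSup_pos h]
    constructor
    · intro hb
      refine Or.inr ⟨h, fun f ↦ D.Bs_toLoc_inj ?_⟩
      have := hb f
      rw [algebraMap_smul] at this
      rw [map_smul]; exact this
    · rintro (rfl | ⟨-, h⟩)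
      · rw [map_zero]; exact zero_mem _
      · intro f
        rw [algebraMap_smul, ← map_smul, h f]; rfl
  · rw [iSup_neg h, Submodule.mem_bot, ← map_zero (Bs σ 𝒢 s).toLoc]
    constructor
    · exact fun h ↦ Or.inl (D.Bs_toLoc_inj h)
    · rintro (rfl | ⟨h', -⟩)
      · rfl
      · exact absurd h' h

theorem ext_of_eigen_one (b : (Bs σ 𝒢 s).Right) (h : ∀ f, f • b = (Bs σ 𝒢 s).leftMul f b) :
    ext D.c b = - (σ s D.δ * ext D.d b) := by
  have := D.ext_d_left b
  rw [← h, map_smul, smul_eq_mul] at this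
  linear_combination -this

theorem ext_of_eigen_s (b : (Bs σ 𝒢 s).Right) (h : ∀ f, f • b = (Bs σ 𝒢 s).leftMul (σ s f) b) :
    ext D.c b = - (D.δ * ext D.d b) := by
  have h1 := D.ext_d_left b
  have h2 := congrArg (ext D.d) (h (σ s D.δ))
  rw [D.invol, h1, map_smul, smul_eq_mul] at h2
  linear_combination -h2

/-- `(B_s ⊗ M)_Q` is the sum of two copies of `M_Q`. -/
def locEquiv : ((Bs σ 𝒢 s).tensor M).loc ≃ₗ[FractionRing R] M.loc × M.loc :=
  (LinearEquiv.baseChange R (FractionRing R) _ _ (D.equiv M)).trans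
    (TensorProduct.prodRight R (FractionRing R) (FractionRing R) M.Right M.Right)

theorem locEquiv_toLoc (t : ((Bs σ 𝒢 s).tensor M).Right) :
    D.locEquiv M (((Bs σ 𝒢 s).tensor M).toLoc t) =
      (M.toLoc (coord M D.c t), M.toLoc (coord M D.d t)) := rfl

/-- The change of coordinates on `M_Q × M_Q` which diagonalizes `B_s`. -/
def theta : M.loc × M.loc →ₗ[FractionRing R] M.loc × M.loc :=
  ((M.leftLoc (-σ s D.δ)).coprod (M.leftLoc (-D.δ))).prod
    (LinearMap.coprod LinearMap.id LinearMap.id)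

theorem theta_apply (p : M.loc × M.loc) : D.theta M p =
    (M.leftLoc (-σ s D.δ) p.1 + M.leftLoc (-D.δ) p.2, p.1 + p.2) := rfl

theorem theta_bijective [IsDomain R] (hM : M.IsCPrime σ 𝒢) : Function.Bijective (D.theta M) := by
  constructor
  · rw [← LinearMap.ker_eq_bot, LinearMap.ker_eq_bot']
    rintro ⟨m, m'⟩ h
    rw [theta_apply, Prod.mk_eq_zero] at h
    obtain ⟨h1, h2⟩ := h
    obtain rfl : m' = -m := by rw [eq_neg_iff_add_eq_zero, add_comm]; exact h2
    have : M.leftLoc (D.δ - σ s D.δ) m = 0 := by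
      rw [sub_eq_add_neg, Bimod.leftLoc_add, ← h1, Bimod.leftLoc_neg _ D.δ, map_neg, neg_neg, add_comm]
    have := hM.left_injective D.ne_zero m this
    simp [this]
  · rintro ⟨p, q⟩
    obtain ⟨m, hm⟩ := hM.left_surjective D.ne_zero (p + M.leftLoc D.δ q)
    refine ⟨(m, q - m), ?_⟩
    rw [theta_apply]
    refine Prod.ext ?_ (add_sub_cancel m q)
    rw [sub_eq_add_neg, Bimod.leftLoc_add] at hm
    simp only [Bimod.leftLoc_neg, map_sub] at hm ⊢
    rw [← sub_eq_zero, ← sub_eq_zero.2 hm]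
    abel

/-- The coordinates on `(B_s ⊗ M)_Q` in which the decomposition is visible. -/
def psi [IsDomain R] (hM : M.IsCPrime σ 𝒢) :
    ((Bs σ 𝒢 s).tensor M).loc ≃ₗ[FractionRing R] M.loc × M.loc :=
  (D.locEquiv M).trans (LinearEquiv.ofBijective (D.theta M) (D.theta_bijective M hM)).symm

theorem psi_eq_iff [IsDomain R] (hM : M.IsCPrime σ 𝒢) (z) (p) :
    D.psi M hM z = p ↔ D.locEquiv M z = D.theta M p := by
  unfold psi
  rw [LinearEquiv.trans_apply, LinearEquiv.symm_apply_eq]; rfl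

/-- The tensor `b ⊗ m` in `B_s ⊗ M`. -/
def tn (b : (Bs σ 𝒢 s).Right) (m : M.Right) : ((Bs σ 𝒢 s).tensor M).Right :=
  (b ⊗ₜ[R] m : (Bs σ 𝒢 s).Right ⊗[R] M.Left)

theorem coord_tn (c : R →ₗ[fixed (σ s)] R) (b : (Bs σ 𝒢 s).Right) (m : M.Right) :
    coord M c (tn M b m) = M.leftMul (ext c b) m := rfl

theorem psi_tn_one [IsDomain R] (hM : M.IsCPrime σ 𝒢) (b : (Bs σ 𝒢 s).Right)
    (h : ∀ f, f • b = (Bs σ 𝒢 s).leftMul f b) (m : M.Right) :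
    D.psi M hM (((Bs σ 𝒢 s).tensor M).toLoc (tn M b m)) = (M.leftLoc (ext D.d b) (M.toLoc m), 0) := by
  rw [psi_eq_iff, locEquiv_toLoc, theta_apply, coord_tn, coord_tn, D.ext_of_eigen_one b h]
  simp only [map_zero, add_zero, ← Bimod.leftLoc_mul, ← Bimod.leftLoc_toLoc, neg_mul]

theorem psi_tn_s [IsDomain R] (hM : M.IsCPrime σ 𝒢) (b : (Bs σ 𝒢 s).Right)
    (h : ∀ f, f • b = (Bs σ 𝒢 s).leftMul (σ s f) b) (m : M.Right) :
    D.psi M hM (((Bs σ 𝒢 s).tensor M).toLoc (tn M b m)) = (0, M.leftLoc (ext D.d b) (M.toLoc m)) := by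
  rw [psi_eq_iff, locEquiv_toLoc, theta_apply, coord_tn, coord_tn, D.ext_of_eigen_s b h]
  simp only [map_zero, zero_add, ← Bimod.leftLoc_mul, ← Bimod.leftLoc_toLoc, neg_mul]

/-- A generator of `(B_s)_Q ^ e`. -/
def genOne : (Bs σ 𝒢 s).Right := bt D.δ 1 - bt 1 (σ s D.δ)

/-- A generator of `(B_s)_Q ^ s`. -/
def genS : (Bs σ 𝒢 s).Right := bt D.δ 1 - bt 1 D.δ

theorem ext_genOne : ext D.d D.genOne = 1 := by
  rw [genOne, map_sub, ext_bt, ext_bt, D.d_δ, D.d_one]; ring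

theorem ext_genS : ext D.d D.genS = 1 := by
  rw [genS, map_sub, ext_bt, ext_bt, D.d_δ, D.d_one]; ring

theorem genOne_eigen (f : R) : f • D.genOne = (Bs σ 𝒢 s).leftMul f D.genOne := by
  have fx {k : R} (hk : k ∈ fixed (σ s)) :
      k ⊗ₜ[fixed (σ s)] (1 : R) = (1 : R) ⊗ₜ[fixed (σ s)] k := by
    have := TensorProduct.smul_tmul (R := fixed (σ s)) (⟨k, hk⟩ : fixed (σ s)) (1 : R) (1 : R)
    rwa [show (⟨k, hk⟩ : fixed (σ s)) • (1 : R) = k from mul_one k] at this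
  set L : R →+* R ⊗[fixed (σ s)] R := Algebra.TensorProduct.includeLeftRingHom with hL
  set Rr : R →+* R ⊗[fixed (σ s)] R :=
    (Algebra.TensorProduct.includeRight : R →ₐ[fixed (σ s)] R ⊗[fixed (σ s)] R).toRingHom with hR
  have fx' {k : R} (hk : k ∈ fixed (σ s)) : L k = Rr k := fx hk
  change Rr f * (L D.δ - Rr (σ s D.δ)) = L f * (L D.δ - Rr (σ s D.δ))
  have h1 := fx' (D.c_mem f)
  have h2 := fx' (D.d_mem f)
  have h3 := fx' D.trace_mem
  have h4 := fx' D.norm_mem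
  have h5 := congrArg L (D.eq_add f)
  have h6 := congrArg Rr (D.eq_add f)
  simp only [map_add, map_mul] at h1 h2 h3 h4 h5 h6
  rw [h5, h6, h1, h2]
  linear_combination -Rr (D.d f) * L D.δ * h3 + Rr (D.d f) * h4

theorem genS_eigen (f : R) : f • D.genS = (Bs σ 𝒢 s).leftMul (σ s f) D.genS := by
  have fx {k : R} (hk : k ∈ fixed (σ s)) :
      k ⊗ₜ[fixed (σ s)] (1 : R) = (1 : R) ⊗ₜ[fixed (σ s)] k := by
    have := TensorProduct.smul_tmul (R := fixed (σ s)) (⟨k, hk⟩ : fixed (σ s)) (1 : R) (1 : R)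
    rwa [show (⟨k, hk⟩ : fixed (σ s)) • (1 : R) = k from mul_one k] at this
  set L : R →+* R ⊗[fixed (σ s)] R := Algebra.TensorProduct.includeLeftRingHom with hL
  set Rr : R →+* R ⊗[fixed (σ s)] R :=
    (Algebra.TensorProduct.includeRight : R →ₐ[fixed (σ s)] R ⊗[fixed (σ s)] R).toRingHom with hR
  have fx' {k : R} (hk : k ∈ fixed (σ s)) : L k = Rr k := fx hk
  change Rr f * (L D.δ - Rr D.δ) = L (σ s f) * (L D.δ - Rr D.δ)
  have h1 := fx' (D.c_mem f)
  have h2 := fx' (D.d_mem f)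
  have h3 := fx' D.trace_mem
  have h4 := fx' D.norm_mem
  have h5 : L (σ s f) = L (D.c f) + L (σ s D.δ) * L (D.d f) := by
    rw [← map_mul, ← map_add]
    congr 1
    conv_lhs => rw [D.eq_add f]
    rw [map_add, map_mul, show σ s (D.c f) = D.c f from D.c_mem f,
      show σ s (D.d f) = D.d f from D.d_mem f]
  have h6 := congrArg Rr (D.eq_add f)
  simp only [map_add, map_mul] at h1 h2 h3 h4 h5 h6
  rw [h5, h6, h1, h2]
  linear_combination (Rr (D.d f) * Rr D.δ) * h3 - Rr (D.d f) * h4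

end SplitData
theorem DecBimod.tensor_mem_stalk (M N : DecBimod K R W) {x y : W} {m : M.Right} {n : N.Right}
    (hm : m ∈ M.sub x) (hn : n ∈ N.sub y) :
    (M.tensor N).toLoc (m ⊗ₜ[R] n : M.Right ⊗[R] N.Left) ∈ (M.tensor N).stalk (x * y) := by
  have : (M.toBimod.tensor N.toBimod).toLoc (m ⊗ₜ[R] n : M.Right ⊗[R] N.Left) ∈
    ⨆ p : {p : W × W // p.1 * p.2 = x * y},
      Submodule.span (FractionRing R) {z | ∃ m ∈ M.sub p.1.1, ∃ m' ∈ N.sub p.1.2,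
        z = (M.toBimod.tensor N.toBimod).toLoc (m ⊗ₜ[R] m' : M.Right ⊗[R] N.Left)} :=
    Submodule.mem_iSup_of_mem ⟨(x, y), rfl⟩ (Submodule.subset_span ⟨m, hm, n, hn, rfl⟩)
  exact this

theorem DecBimod.tensor_mem_grade (M N : DecBimod K R W) {i j k : ℤ} {m : M.Right} {n : N.Right}
    (hm : m ∈ M.grade i) (hn : n ∈ N.grade j) (hk : i + j = k) :
    (m ⊗ₜ[R] n : M.Right ⊗[R] N.Left) ∈ (M.tensor N).grade k := by
  have : (m ⊗ₜ[R] n : M.Right ⊗[R] N.Left) ∈ Submodule.span K {t : M.Right ⊗[R] N.Left |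
      ∃ i j : ℤ, ∃ m : M.Right, ∃ m' : N.Left,
        m ∈ M.grade i ∧ m' ∈ N.grade j ∧ i + j = k ∧ t = m ⊗ₜ[R] m'} :=
    Submodule.subset_span ⟨i, j, m, n, hm, hn, hk, rfl⟩
  exact this

namespace SplitData

variable {σ : W →* (R →ₐ[K] R)} {𝒢 : ℤ → Submodule K R} {s : W} (D : SplitData (σ s) 𝒢)
variable (M : DecBimod K R W)

theorem bt_mem_grade {i j k : ℤ} {f g : R} (hf : f ∈ 𝒢 i) (hg : g ∈ 𝒢 j) (hk : i + j = k + 1) :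
    bt (σ := σ) (𝒢 := 𝒢) (s := s) f g ∈ (Bs σ 𝒢 s).grade k := by
  have : (f ⊗ₜ[fixed (σ s)] g : R ⊗[fixed (σ s)] R) ∈ Submodule.span K
      {t : R ⊗[fixed (σ s)] R | ∃ i j : ℤ, ∃ f ∈ 𝒢 i, ∃ g ∈ 𝒢 j,
        i + j = k + 1 ∧ t = f ⊗ₜ[fixed (σ s)] g} :=
    Submodule.subset_span ⟨i, j, f, hf, g, hg, hk, rfl⟩
  exact this

theorem tensor_stalk [IsDomain R] (hM : M.IsCPrime σ 𝒢) (g : W) :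
    ((Bs σ 𝒢 s).tensor M).stalk g =
      ((M.stalk g).prod (M.stalk (s⁻¹ * g))).comap (D.psi M hM).toLinearMap := by
  apply le_antisymm
  · refine iSup_le fun p ↦ Submodule.span_le.2 ?_
    rintro z ⟨b, hb, m, hm, rfl⟩
    obtain ⟨⟨p, q⟩, rfl⟩ := p
    change D.psi M hM (((Bs σ 𝒢 s).tensor M).toLoc (tn M b m)) ∈
      (M.stalk (p * q)).prod (M.stalk (s⁻¹ * (p * q)))
    rw [D.mem_Bs_sub] at hb
    obtain rfl | ⟨rfl | rfl, h⟩ := hb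
    · rw [show tn (σ := σ) (𝒢 := 𝒢) (s := s) M 0 m = 0 from TensorProduct.zero_tmul _ _, map_zero,
        map_zero]
      exact zero_mem _
    · rw [psi_tn_one]
      · refine ⟨?_, zero_mem _⟩
        rw [one_mul]
        exact hM.left_mem_stalk _ _ hm
      · simpa using h
    · rw [psi_tn_s _ _ _ _ h]
      refine ⟨zero_mem _, ?_⟩
      rw [inv_mul_cancel_left]
      exact hM.left_mem_stalk _ _ hm
  · intro z hz
    obtain ⟨m, m', hp⟩ : ∃ m m', D.psi M hM z = (m, m') := ⟨_, _, rfl⟩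
    have hz' : D.psi M hM z ∈ (M.stalk g).prod (M.stalk (s⁻¹ * g)) := hz
    rw [hp] at hz'
    obtain ⟨hm, hm'⟩ := hz'
    obtain ⟨q, r, n, hn, hr⟩ := M.exists_smul_toLoc m
    obtain ⟨q', r', n', hn', hr'⟩ := M.exists_smul_toLoc m'
    have hz2 : z = q • ((Bs σ 𝒢 s).tensor M).toLoc (tn M D.genOne n) +
        q' • ((Bs σ 𝒢 s).tensor M).toLoc (tn M D.genS n') := by
      apply (D.psi M hM).injective
      rw [map_add, map_smul, map_smul, psi_tn_one _ _ _ _ D.genOne_eigen,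
        psi_tn_s _ _ _ _ D.genS_eigen, D.ext_genOne, D.ext_genS, hp, hn, hn']
      simp [Bimod.leftLoc_toLoc]
    have ht (x y : W) (hxy : x * y = g) (b : (Bs σ 𝒢 s).Right) (hb : b ∈ (Bs σ 𝒢 s).sub x)
        (k : M.Right) (hk : M.toLoc k ∈ M.stalk y) :
        ((Bs σ 𝒢 s).tensor M).toLoc (tn M b k) ∈ ((Bs σ 𝒢 s).tensor M).stalk g :=
      hxy ▸ (Bs σ 𝒢 s).tensor_mem_stalk M hb hk
    have key {z₁ z₂ : ((Bs σ 𝒢 s).tensor M).loc} (h₁ : z₁ ∈ ((Bs σ 𝒢 s).tensor M).stalk g)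
        (h₂ : z₂ ∈ ((Bs σ 𝒢 s).tensor M).stalk g) :
        q • z₁ + q' • z₂ ∈ ((Bs σ 𝒢 s).tensor M).stalk g :=
      add_mem (Submodule.smul_mem _ _ h₁) (Submodule.smul_mem _ _ h₂)
    rw [hz2]
    refine key ?_ ?_
    · refine ht 1 g (one_mul g) _ ?_ _ ?_
      · rw [D.mem_Bs_sub]
        exact Or.inr ⟨Or.inl rfl, by simpa using D.genOne_eigen⟩
      · rw [← hr, ← algebraMap_smul (FractionRing R)]
        exact Submodule.smul_mem _ _ hm
    · refine ht s (s⁻¹ * g) (mul_inv_cancel_left s g) _ ?_ _ ?_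
      · rw [D.mem_Bs_sub]
        exact Or.inr ⟨Or.inr rfl, D.genS_eigen⟩
      · rw [← hr', ← algebraMap_smul (FractionRing R)]
        exact Submodule.smul_mem _ _ hm'

theorem ext_grade (h𝒢 : ∀ i j, ∀ a ∈ 𝒢 i, ∀ b ∈ 𝒢 j, a * b ∈ 𝒢 (i + j))
    (c : R →ₗ[fixed (σ s)] R) (e : ℤ) (hc : ∀ i, ∀ f ∈ 𝒢 i, c f ∈ 𝒢 (i + e)) (i : ℤ)
    (b : (Bs σ 𝒢 s).Right) (hb : b ∈ (Bs σ 𝒢 s).grade i) :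
    ext (𝒢 := 𝒢) c b ∈ 𝒢 (i + 1 + e) := by
  induction hb using Submodule.span_induction with
  | mem b hb =>
    obtain ⟨p, q, f, hf, g, hg, hpq, rfl⟩ := hb
    have := h𝒢 _ _ _ (hc p f hf) g hg
    rw [show p + e + q = i + 1 + e by omega] at this
    exact this
  | zero => exact (map_zero (ext (𝒢 := 𝒢) c)).symm ▸ zero_mem _
  | add x y _ _ hx hy => exact (map_add (ext (𝒢 := 𝒢) c) x y).symm ▸ add_mem hx hy
  | smul k x _ hx =>
    have := (ext (𝒢 := 𝒢) c).map_smul_of_tower k (show (Bs σ 𝒢 s).Right from x)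
    exact this.symm ▸ Submodule.smul_mem _ k hx

theorem coord_grade (hM : M.IsCPrime σ 𝒢)
    (h𝒢 : ∀ i j, ∀ a ∈ 𝒢 i, ∀ b ∈ 𝒢 j, a * b ∈ 𝒢 (i + j))
    (c : R →ₗ[fixed (σ s)] R) (e : ℤ) (hc : ∀ i, ∀ f ∈ 𝒢 i, c f ∈ 𝒢 (i + e)) (i : ℤ)
    (t : ((Bs σ 𝒢 s).tensor M).Right) (ht : t ∈ ((Bs σ 𝒢 s).tensor M).grade i) :
    coord M c t ∈ M.grade (i + 1 + e) := by
  induction ht using Submodule.span_induction with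
  | mem b hb =>
    obtain ⟨p, q, b, m, hb, hm, hpq, rfl⟩ := hb
    have := hM.left_mem _ _ _ m (ext_grade h𝒢 c e hc p b hb) hm
    rw [show p + 1 + e + q = i + 1 + e by omega] at this
    exact this
  | zero => exact (map_zero (coord M c)).symm ▸ zero_mem _
  | add x y _ _ hx hy => exact (map_add (coord M c) x y).symm ▸ add_mem hx hy
  | smul k x _ hx =>
    have := (coord M c).map_smul_of_tower k (show ((Bs σ 𝒢 s).tensor M).Right from x)
    exact this.symm ▸ Submodule.smul_mem _ k hx

theorem tensor_grade (hM : M.IsCPrime σ 𝒢)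
    (h𝒢 : ∀ i j, ∀ a ∈ 𝒢 i, ∀ b ∈ 𝒢 j, a * b ∈ 𝒢 (i + j)) (h1 : 1 ∈ 𝒢 0) (i : ℤ) :
    ((Bs σ 𝒢 s).tensor M).grade i = ((M.grade (i + 1)).prod (M.grade (i - 1))).comap
      ((D.equiv M).toLinearMap.restrictScalars K) := by
  apply le_antisymm
  · intro t ht
    refine ⟨?_, ?_⟩
    · have := coord_grade M hM h𝒢 D.c 0 (fun i f hf ↦ by rw [add_zero]; exact D.c_grade i f hf) i t ht
      rwa [add_zero] at this
    · have := coord_grade M hM h𝒢 D.d (-2) (fun i f hf ↦ by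
        have := D.d_grade (i - 1) f (by rwa [sub_add_cancel])
        rwa [show i - 1 - 1 = i + -2 by ring] at this) i t ht
      rwa [show i + 1 + -2 = i - 1 by ring] at this
  · rintro t ⟨h, h'⟩
    have h2 : t = tm M 1 1 (D.equiv M t).1 + tm M D.δ 1 (D.equiv M t).2 :=
      ((D.equiv M).symm_apply_apply t).symm
    have key {z₁ z₂ : ((Bs σ 𝒢 s).tensor M).carrier} (h₁ : z₁ ∈ ((Bs σ 𝒢 s).tensor M).grade i)
        (h₂ : z₂ ∈ ((Bs σ 𝒢 s).tensor M).grade i) :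
        z₁ + z₂ ∈ ((Bs σ 𝒢 s).tensor M).grade i := add_mem h₁ h₂
    rw [h2]
    have e1 : bt (σ := σ) (𝒢 := 𝒢) (s := s) 1 1 ∈ (Bs σ 𝒢 s).grade (-1) :=
      bt_mem_grade h1 h1 (by ring)
    have e2 : bt (σ := σ) (𝒢 := 𝒢) (s := s) D.δ 1 ∈ (Bs σ 𝒢 s).grade 1 :=
      bt_mem_grade D.δ_mem h1 (by ring)
    exact key ((Bs σ 𝒢 s).tensor_mem_grade M e1 h (by ring))
      ((Bs σ 𝒢 s).tensor_mem_grade M e2 h' (by ring))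

/-- `B_s ⊗ M` is an object of `C` if `M` is. -/
theorem tensor_isC (D : SplitData (σ s) 𝒢) [IsDomain R] (hM : M.IsC σ 𝒢)
    (h𝒢 : ∀ i j, ∀ a ∈ 𝒢 i, ∀ b ∈ 𝒢 j, a * b ∈ 𝒢 (i + j)) (h1 : 1 ∈ 𝒢 0) :
    ((Bs σ 𝒢 s).tensor M).IsC σ 𝒢 where
  grade_indep := by
    have := iSupIndep_comap ((D.equiv M).restrictScalars K) (iSupIndep_prod
      (hM.grade_indep.comp (f := fun i : ℤ ↦ i + 1) (add_left_injective 1))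
      (hM.grade_indep.comp (f := fun i : ℤ ↦ i - 1) (fun a b h ↦ by simpa using h)))
    exact (funext (D.tensor_grade M hM.toIsCPrime h𝒢 h1) : ((Bs σ 𝒢 s).tensor M).grade = _) ▸ this
  grade_iSup := by
    have e1 : ⨆ i : ℤ, M.grade (i + 1) = ⊤ :=
      ((Equiv.addRight (1 : ℤ)).iSup_comp (g := M.grade)).trans hM.grade_iSup
    have e2 : ⨆ i : ℤ, M.grade (i - 1) = ⊤ :=
      ((Equiv.subRight (1 : ℤ)).iSup_comp (g := M.grade)).trans hM.grade_iSup
    have := iSup_comap_eq_top ((D.equiv M).restrictScalars K) (iSup_prod_eq_top e1 e2)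
    exact Eq.trans (iSup_congr fun i ↦ D.tensor_grade M hM.toIsCPrime h𝒢 h1 i) this
  left_mem i j a t ha ht := by
    have hB (p : ℤ) : (Bs σ 𝒢 s).grade p ≤
        ((Bs σ 𝒢 s).grade (i + p)).comap ((Bs σ 𝒢 s).left a) := by
      refine Submodule.span_le.2 ?_
      rintro b ⟨p', q', f, hf, g, hg, hpq', rfl⟩
      refine Submodule.subset_span ⟨i + p', q', a * f, h𝒢 _ _ _ ha _ hf, g, hg, by omega, ?_⟩
      exact left_bt a f g
    have : ((Bs σ 𝒢 s).tensor M).grade j ≤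
        (((Bs σ 𝒢 s).tensor M).grade (i + j)).comap (((Bs σ 𝒢 s).tensor M).left a) := by
      refine Submodule.span_le.2 ?_
      rintro t ⟨p, q, b, m, hb, hm, hpq, rfl⟩
      exact Submodule.subset_span ⟨i + p, q, (Bs σ 𝒢 s).leftMul a b, m, hB p hb, hm, by omega, rfl⟩
    exact this ht
  right_mem i j a t ha ht := by
    have : ((Bs σ 𝒢 s).tensor M).grade j ≤
        (((Bs σ 𝒢 s).tensor M).grade (j + i)).comap (((Bs σ 𝒢 s).tensor M).right a) := by
      refine Submodule.span_le.2 ?_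
      rintro t ⟨p, q, b, m, hb, hm, hpq, rfl⟩
      exact Submodule.subset_span ⟨p, q + i, b, M.rightMul a m, hb, hM.right_mem _ _ _ _ ha hm,
        by omega, rfl⟩
    exact this ht
  stalk_indep := by
    have := iSupIndep_comap (D.psi M hM.toIsCPrime) (iSupIndep_prod hM.stalk_indep
      (hM.stalk_indep.comp (f := fun g : W ↦ s⁻¹ * g) (mul_right_injective s⁻¹)))
    convert this using 1
    funext g
    exact D.tensor_stalk M hM.toIsCPrime g
  stalk_iSup := by
    have e2 : ⨆ g : W, M.stalk (s⁻¹ * g) = ⊤ :=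
      ((Equiv.mulLeft s⁻¹).iSup_comp (g := M.stalk)).trans hM.stalk_iSup
    have := iSup_comap_eq_top (D.psi M hM.toIsCPrime) (iSup_prod_eq_top hM.stalk_iSup e2)
    rw [← this]
    exact iSup_congr fun g ↦ D.tensor_stalk M hM.toIsCPrime g
  stalk_finite := by
    refine (hM.stalk_finite.union (hM.stalk_finite.image (s * ·))).subset fun g hg ↦ ?_
    by_contra h
    rw [Set.mem_union, not_or] at h
    obtain ⟨h2, h3⟩ := h
    have h2 : M.stalk g = ⊥ := not_not.1 h2
    have h3 : M.stalk (s⁻¹ * g) = ⊥ := by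
      by_contra h4
      exact h3 ⟨s⁻¹ * g, h4, mul_inv_cancel_left s g⟩
    apply hg
    rw [D.tensor_stalk M hM.toIsCPrime g, h2, h3, Submodule.prod_bot]
    exact LinearMap.ker_eq_bot.2 (D.psi M hM.toIsCPrime).injective
  stalk_smul g f z hz := by
    have hflat := hM.flat
    have : ((Bs σ 𝒢 s).tensor M).stalk g ≤ ((Bs σ 𝒢 s).tensor M).eigen (σ g) := by
      refine iSup_le fun p ↦ Submodule.span_le.2 ?_
      rintro z ⟨b, hb, m, hm, rfl⟩ f
      obtain ⟨⟨p, q⟩, rfl⟩ := p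
      have hm' : M.rightMul f m = M.leftMul (σ q f) m := by
        apply toLoc_injective M.toBimod
        have := hM.stalk_smul q f _ hm
        rw [algebraMap_smul, ← map_smul] at this
        exact this
      have hb' : ∀ f, f • b = (Bs σ 𝒢 s).leftMul (σ p f) b := by
        rw [D.mem_Bs_sub] at hb
        obtain rfl | ⟨-, h⟩ := hb
        · simp
        · exact h
      refine (algebraMap_smul (FractionRing R) f (((Bs σ 𝒢 s).tensor M).toLoc (tn M b m))).trans ?_
      rw [← map_smul]
      change ((Bs σ 𝒢 s).tensor M).toLoc (tn M b (M.rightMul f m)) =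
        ((Bs σ 𝒢 s).tensor M).toLoc (tn M ((Bs σ 𝒢 s).leftMul (σ (p * q) f) b) m)
      rw [hm', map_mul, AlgHom.mul_apply, ← hb']
      congr 1
      exact (TensorProduct.smul_tmul (R := R) (σ q f) b (show M.Left from m)).symm
    exact this hz f
  finitelyGenerated := by
    classical
    obtain ⟨F, hF⟩ := hM.finitelyGenerated
    refine ⟨F.image (tm M 1 1) ∪ F.image (fun m ↦ tm M 1 1 (M.leftMul D.δ m)), fun N hN hl hr ↦ ?_⟩
    have e (f g : R) (m : M.Right) : (((Bs σ 𝒢 s).tensor M).leftMul f) (tm M g 1 m) =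
        tm M (f * g) 1 m := congrArg (fun b ↦ tn M b m) (left_bt f g 1)
    have fx (k : R) (hk : k ∈ fixed (σ s)) (m : M.Right) :
        tm M 1 1 (M.leftMul k m) = ((Bs σ 𝒢 s).tensor M).leftMul k (tm M 1 1 m) := by
      rw [e, ← tm_mul, mul_one, ← one_mul k, tm_fixed M 1 1 k hk, one_mul, mul_one]
    let P : AddSubgroup M.carrier :=
      { carrier := {m | tm M 1 1 m ∈ N ∧ tm M 1 1 (M.leftMul D.δ m) ∈ N}
        add_mem' := by
          rintro a b ⟨h1, h2⟩ ⟨h3, h4⟩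
          refine ⟨(tm_add_right M 1 1 a b).symm ▸ add_mem h1 h3, ?_⟩
          have := tm_add_right (σ := σ) (𝒢 := 𝒢) (s := s) M 1 1 (M.leftMul D.δ a) (M.leftMul D.δ b)
          exact (map_add (M.leftMul D.δ) a b) ▸ this.symm ▸ add_mem h2 h4
        zero_mem' := by
          refine ⟨(tm_zero M 1 1).symm ▸ zero_mem N, ?_⟩
          exact (map_zero (M.leftMul D.δ)).symm ▸ (tm_zero M 1 1).symm ▸ zero_mem N
        neg_mem' := by
          rintro a ⟨h1, h2⟩
          have hn (m : M.Right) : tm (σ := σ) (𝒢 := 𝒢) (s := s) M 1 1 (-m) = - tm M 1 1 m :=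
            TensorProduct.tmul_neg _ _
          refine ⟨(hn a).symm ▸ neg_mem h1, ?_⟩
          exact (map_neg (M.leftMul D.δ) a).symm ▸ (hn _).symm ▸ neg_mem h2 }
    have hk (k : R) (hk : k ∈ fixed (σ s)) (m : M.Right) (hm : tm M 1 1 m ∈ N) :
        tm M 1 1 (M.leftMul k m) ∈ N := by
      rw [fx k hk]; exact hl _ _ hm
    have hδ (m : M.Right) (hm : tm M 1 1 m ∈ N ∧ tm M 1 1 (M.leftMul D.δ m) ∈ N) :
        tm M 1 1 (M.leftMul D.δ (M.leftMul D.δ m)) ∈ N := by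
      have : M.leftMul D.δ (M.leftMul D.δ m) =
          M.leftMul (D.δ + σ s D.δ) (M.leftMul D.δ m) + -(M.leftMul (D.δ * σ s D.δ) m) := by
        rw [← Module.End.mul_apply, ← Module.End.mul_apply, ← map_mul, ← map_mul,
          ← LinearMap.neg_apply, ← map_neg, ← LinearMap.add_apply, ← map_add]
        congr 2; ring
      rw [this, tm_add_right]
      refine add_mem (hk _ D.trace_mem _ hm.2) ?_
      rw [show tm (σ := σ) (𝒢 := 𝒢) (s := s) M 1 1 (-(M.leftMul (D.δ * σ s D.δ) m)) =
        - tm M 1 1 (M.leftMul (D.δ * σ s D.δ) m) from TensorProduct.tmul_neg _ _]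
      exact neg_mem (hk _ D.norm_mem _ hm.1)
    have hcomm (a b : R) (m : M.Right) :
        M.leftMul a (M.leftMul b m) = M.leftMul b (M.leftMul a m) := by
      rw [← Module.End.mul_apply, ← map_mul, mul_comm, map_mul]; rfl
    have hP : P = ⊤ := by
      refine hF P (fun m hm ↦ ⟨hN ?_, hN ?_⟩) (fun a m hm ↦ ?_) (fun a m hm ↦ ⟨?_, ?_⟩)
      · exact Finset.mem_coe.2 (Finset.mem_union_left _ (Finset.mem_image_of_mem _ hm))
      · exact Finset.mem_coe.2 (Finset.mem_union_right _ (Finset.mem_image_of_mem _ hm))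
      · have hc : M.leftMul (D.c a) m ∈ P := by
          refine ⟨hk _ (D.c_mem a) _ hm.1, ?_⟩
          exact hcomm (D.c a) D.δ m ▸ hk _ (D.c_mem a) _ hm.2
        have hd : M.leftMul (D.d a) m ∈ P := by
          refine ⟨hk _ (D.d_mem a) _ hm.1, ?_⟩
          exact hcomm (D.d a) D.δ m ▸ hk _ (D.d_mem a) _ hm.2
        have hd' : M.leftMul D.δ (M.leftMul (D.d a) m) ∈ P := ⟨hd.2, hδ _ hd⟩
        have : M.leftMul a m = M.leftMul (D.c a) m + M.leftMul D.δ (M.leftMul (D.d a) m) := by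
          conv_lhs => rw [D.eq_add a]
          rw [map_add, map_mul]; rfl
        change M.leftMul a m ∈ P
        rw [this]
        exact P.add_mem hc hd'
      · exact hr a _ hm.1
      · have := hr a _ hm.2
        have h2 : M.rightMul a (M.leftMul D.δ m) = M.leftMul D.δ (M.rightMul a m) :=
          (M.left_right _ _ _).symm
        change tm M 1 1 (M.rightMul a (M.leftMul D.δ m)) ∈ N at this
        rwa [h2] at this
    have h11 (m : M.Right) : tm M 1 1 m ∈ N := by
      have : m ∈ P := hP ▸ AddSubgroup.mem_top (G := M.carrier) m
      exact this.1
    rw [eq_top_iff]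
    intro t _
    refine tm_ind (P := fun t ↦ t ∈ N) M (zero_mem N) (fun x y hx hy ↦ add_mem hx hy) ?_ t
    intro f g m
    rw [tm_mul]
    have := hl f _ (h11 (M.leftMul g m))
    have h2 := e f 1 (M.leftMul g m)
    rw [mul_one] at h2
    exact h2 ▸ this
  flat := by
    have := hM.flat
    have := flat_prod (S := R) (M := M.Right)
    exact .of_linearEquiv (D.equiv M)

end SplitData
theorem unit_isC {σ : W →* (R →ₐ[K] R)} {𝒢 : ℤ → Submodule K R}
    (hi : iSupIndep 𝒢) (ht : ⨆ i, 𝒢 i = ⊤)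
    (h𝒢 : ∀ i j, ∀ a ∈ 𝒢 i, ∀ b ∈ 𝒢 j, a * b ∈ 𝒢 (i + j)) :
    (DecBimod.unit W 𝒢).IsC σ 𝒢 where
  grade_indep := hi
  grade_iSup := ht
  left_mem i j a m ha hm := h𝒢 i j a ha m hm
  right_mem i j a m ha hm := by
    rw [add_comm]
    exact h𝒢 i j a ha m hm
  stalk_indep g := by
    by_cases h : g = 1
    · rw [disjoint_comm]
      have : ⨆ j, ⨆ _ : j ≠ g, (DecBimod.unit W 𝒢).stalk j = ⊥ := by
        refine eq_bot_iff.2 (iSup₂_le fun j hj ↦ iSup_le fun hj' ↦ ?_)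
        exact absurd (hj'.trans h.symm) hj
      rw [this]
      exact disjoint_bot_left
    · have : (DecBimod.unit W 𝒢).stalk g = ⊥ := iSup_neg h
      rw [this]
      exact disjoint_bot_left
  stalk_iSup := eq_top_iff.2 (le_iSup_of_le 1 (le_iSup_of_le rfl le_rfl))
  stalk_finite := (Set.finite_singleton 1).subset fun g hg ↦ by
    by_contra h
    exact hg (iSup_neg h)
  stalk_smul g f z hz := by
    by_cases h : g = 1
    · subst h
      rw [map_one]
      refine (algebraMap_smul (FractionRing R) f z).trans ?_
      clear hz
      change FractionRing R ⊗[R] (DecBimod.unit W 𝒢).Right at z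
      induction z with
      | zero => simp
      | add x y hx hy => rw [smul_add, hx, hy, map_add]
      | tmul q m => exact (TensorProduct.tmul_smul f q m).symm
    · have : (DecBimod.unit W 𝒢).stalk g = ⊥ := iSup_neg h
      rw [this, Submodule.mem_bot] at hz
      rw [hz, smul_zero, map_zero]
  finitelyGenerated := by
    refine ⟨{(1 : R)}, fun N hN hl _ ↦ ?_⟩
    rw [eq_top_iff]
    intro (a : R) _
    have := hl a (1 : R) (hN (Finset.mem_coe.2 (Finset.mem_singleton_self (1 : R))))
    have h2 : (a * 1 : R) = a := mul_one a
    exact h2 ▸ this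
  flat := (inferInstance : Module.Flat R R)

end Helpers

/-! The symmetric algebra and Soergel bimodules. -/

section SymGrade

variable (K : Type u) [CommRing K] (V : Type v) [AddCommGroup V] [Module K V]

theorem prod_mem_symGrade (l : List V) {n : ℤ} (hn : 2 * (l.length : ℤ) = n) :
    (l.map (SymmetricAlgebra.ι K V)).prod ∈ symGrade K V n :=
  Submodule.subset_span ⟨l, hn, rfl⟩

theorem ι_mem_symGrade (v : V) : SymmetricAlgebra.ι K V v ∈ symGrade K V 2 := by
  simpa using prod_mem_symGrade K V [v] (n := 2) (by simp)

theorem mul_mem_symGrade (i j : ℤ) (a) (ha : a ∈ symGrade K V i) (b) (hb : b ∈ symGrade K V j) :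
    a * b ∈ symGrade K V (i + j) := by
  induction ha using Submodule.span_induction with
  | mem a ha =>
    obtain ⟨l, hl, rfl⟩ := ha
    induction hb using Submodule.span_induction with
    | mem b hb =>
      obtain ⟨l', hl', rfl⟩ := hb
      rw [← List.prod_append, ← List.map_append]
      exact prod_mem_symGrade K V _ (by rw [List.length_append]; push_cast; omega)
    | zero => rw [mul_zero]; exact zero_mem _
    | add x y _ _ hx hy => rw [mul_add]; exact add_mem hx hy
    | smul k x _ hx => rw [mul_smul_comm]; exact Submodule.smul_mem _ k hx
  | zero => rw [zero_mul]; exact zero_mem _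
  | add x y _ _ hx hy => rw [add_mul]; exact add_mem hx hy
  | smul k x _ hx => rw [smul_mul_assoc]; exact Submodule.smul_mem _ k hx

theorem one_mem_symGrade : 1 ∈ symGrade K V 0 := by
  simpa using prod_mem_symGrade K V [] (n := 0) (by simp)

instance : SetLike.GradedMonoid (symGrade K V) where
  one_mem := one_mem_symGrade K V
  mul_mem := fun {i j a b} ha hb ↦ mul_mem_symGrade K V i j a ha b hb

/-- The inclusion of `V` into the direct sum of the homogeneous parts. -/
def gradeι : V →ₗ[K] DirectSum ℤ fun i ↦ symGrade K V i :=
  DirectSum.lof K ℤ (fun i ↦ symGrade K V i) 2 ∘ₗ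
    (SymmetricAlgebra.ι K V).codRestrict _ (ι_mem_symGrade K V)

theorem lift_gradeι_prod (l : List V) {n : ℤ} (hn : 2 * (l.length : ℤ) = n) :
    SymmetricAlgebra.lift (gradeι K V) (l.map (SymmetricAlgebra.ι K V)).prod =
      DirectSum.of (fun i ↦ symGrade K V i) n ⟨_, prod_mem_symGrade K V l hn⟩ := by
  induction l generalizing n with
  | nil =>
    obtain rfl : n = 0 := by simpa using hn.symm
    simp only [List.map_nil, List.prod_nil, map_one]
    rfl
  | cons v l ih =>
    obtain rfl : n = 2 + 2 * (l.length : ℤ) := by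
      rw [List.length_cons] at hn; push_cast at hn; omega
    simp only [List.map_cons, List.prod_cons, map_mul]
    rw [ih rfl, SymmetricAlgebra.lift_ι_apply]
    exact DirectSum.of_mul_of _ _

instance symGradedAlgebra : GradedAlgebra (symGrade K V) :=
  GradedAlgebra.ofAlgHom _ (SymmetricAlgebra.lift (gradeι K V))
    (by
      apply SymmetricAlgebra.algHom_ext
      ext v
      change DirectSum.coeAlgHom (symGrade K V) (SymmetricAlgebra.lift (gradeι K V)
        (SymmetricAlgebra.ι K V v)) = SymmetricAlgebra.ι K V v
      rw [SymmetricAlgebra.lift_ι_apply]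
      exact DirectSum.coeAlgHom_of (symGrade K V) 2 _)
    (fun i x ↦ by
      obtain ⟨x, hx⟩ := x
      change SymmetricAlgebra.lift (gradeι K V) x = _
      induction hx using Submodule.span_induction with
      | mem x hx =>
        obtain ⟨l, hl, rfl⟩ := hx
        exact lift_gradeι_prod K V l hl
      | zero => rw [map_zero]; exact (map_zero _).symm
      | add x y hx hy h1 h2 =>
        rw [map_add, h1, h2, ← map_add]; rfl
      | smul k x hx h =>
        rw [map_smul, h, ← DirectSum.lof_eq_of K, ← map_smul]; rfl)

theorem symGrade_indep : iSupIndep (symGrade K V) :=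
  (DirectSum.Decomposition.isInternal (symGrade K V)).submodule_iSupIndep

theorem symGrade_iSup : ⨆ i, symGrade K V i = ⊤ :=
  (DirectSum.Decomposition.isInternal (symGrade K V)).submodule_iSup_eq_top

end SymGrade

section Realization

variable {B : Type*} {W : Type x} [Group W] {M : CoxeterMatrix B}

/-- A representation `V` of `W` over `K` with `α_s ∈ V` and `α_s^∨ ∈ V^*` for simple
reflections `s`. -/
structure Realization (cs : CoxeterSystem M W) (K : Type u) [CommRing K] (V : Type v)
    [AddCommGroup V] [Module K V] where
  ρ : Representation K W V
  root : B → V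
  coroot : B → Module.Dual K V
  coroot_root : ∀ i, coroot i (root i) = 2
  simple_apply : ∀ i v, ρ (cs.simple i) v = v - coroot i v • root i
  coroot_surjective : ∀ i, Function.Surjective (coroot i)
  root_ne_zero : ∀ i, root i ≠ 0

namespace Realization

variable {cs : CoxeterSystem M W} {K : Type u} [CommRing K] {V : Type v} [AddCommGroup V]
  [Module K V] (H : Realization cs K V)

theorem symAct_ι (g : W) (v : V) : symAct H.ρ g (SymmetricAlgebra.ι K V v) =
    SymmetricAlgebra.ι K V (H.ρ g v) := SymmetricAlgebra.lift_ι_apply _ _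

theorem symAct_invol (i : B) (f : SymmetricAlgebra K V) :
    symAct H.ρ (cs.simple i) (symAct H.ρ (cs.simple i) f) = f := by
  rw [← AlgHom.mul_apply, ← map_mul, cs.simple_mul_simple_self, map_one, AlgHom.one_apply]

theorem symAct_simple_ι (i : B) (v : V) :
    symAct H.ρ (cs.simple i) (SymmetricAlgebra.ι K V v) =
      SymmetricAlgebra.ι K V v - H.coroot i v • SymmetricAlgebra.ι K V (H.root i) := by
  rw [symAct_ι, H.simple_apply, map_sub, map_smul]

theorem exists_demazure_prod (i : B) (l : List V) :
    ∃ g ∈ symGrade K V (2 * (l.length : ℤ) - 2),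
      (l.map (SymmetricAlgebra.ι K V)).prod -
        symAct H.ρ (cs.simple i) (l.map (SymmetricAlgebra.ι K V)).prod =
        SymmetricAlgebra.ι K V (H.root i) * g := by
  induction l with
  | nil => exact ⟨0, zero_mem _, by simp⟩
  | cons v l ih =>
    obtain ⟨g, hg, h⟩ := ih
    set p := (l.map (SymmetricAlgebra.ι K V)).prod with hp
    refine ⟨H.coroot i v • p +
      symAct H.ρ (cs.simple i) (SymmetricAlgebra.ι K V v) * g, add_mem ?_ ?_, ?_⟩
    · refine Submodule.smul_mem _ _ (prod_mem_symGrade K V l ?_)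
      rw [List.length_cons]; push_cast; ring
    · have := mul_mem_symGrade K V _ _ _ (ι_mem_symGrade K V (H.ρ (cs.simple i) v)) g hg
      rw [symAct_ι]
      convert this using 2
      rw [List.length_cons]; push_cast; ring
    · rw [List.map_cons, List.prod_cons, ← hp, map_mul, symAct_simple_ι]
      simp only [Algebra.smul_def]
      linear_combination (SymmetricAlgebra.ι K V v - algebraMap K _ (H.coroot i v) *
        SymmetricAlgebra.ι K V (H.root i)) * h

theorem exists_demazure_homog (i : B) (n : ℤ) (f) (hf : f ∈ symGrade K V n) :
    ∃ g ∈ symGrade K V (n - 2), f - symAct H.ρ (cs.simple i) f =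
        SymmetricAlgebra.ι K V (H.root i) * g := by
  induction hf using Submodule.span_induction with
  | mem f hf =>
    obtain ⟨l, rfl, rfl⟩ := hf
    exact H.exists_demazure_prod i l
  | zero => exact ⟨0, zero_mem _, by simp⟩
  | add x y _ _ hx hy =>
    obtain ⟨g, hg, h⟩ := hx
    obtain ⟨g', hg', h'⟩ := hy
    exact ⟨g + g', add_mem hg hg', by rw [mul_add, ← h, ← h', map_add]; ring⟩
  | smul k x _ hx =>
    obtain ⟨g, hg, h⟩ := hx
    exact ⟨k • g, Submodule.smul_mem _ k hg, by rw [mul_smul_comm, ← h, map_smul, smul_sub]⟩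

theorem exists_demazure (i : B) (f : SymmetricAlgebra K V) :
    ∃ g, f - symAct H.ρ (cs.simple i) f = SymmetricAlgebra.ι K V (H.root i) * g := by
  have hf : f ∈ ⨆ n, symGrade K V n := symGrade_iSup K V ▸ Submodule.mem_top
  induction hf using Submodule.iSup_induction' with
  | mem n f hf =>
    obtain ⟨g, -, h⟩ := H.exists_demazure_homog i n f hf
    exact ⟨g, h⟩
  | zero => exact ⟨0, by simp⟩
  | add x y _ _ hx hy =>
    obtain ⟨g, h⟩ := hx
    obtain ⟨g', h'⟩ := hy
    exact ⟨g + g', by rw [mul_add, ← h, ← h', map_add]; ring⟩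

theorem ι_ne_zero [IsDomain K] [Module.Free K V] {v : V} (hv : v ≠ 0) :
    SymmetricAlgebra.ι K V v ≠ 0 := by
  intro h
  apply hv
  let b := Module.Free.chooseBasis K V
  apply b.repr.injective
  ext j
  have := congrArg (SymmetricAlgebra.lift ((LinearMap.toSpanSingleton K (Polynomial K) Polynomial.X) ∘ₗ
    b.coord j)) h
  rw [SymmetricAlgebra.lift_ι_apply, map_zero] at this
  simpa using this

variable [IsDomain K] [Module.Free K V]

/-- The Demazure operator `f ↦ (f - s(f)) / α_s`. -/
def demazureFun (i : B) (f : SymmetricAlgebra K V) : SymmetricAlgebra K V :=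
  (H.exists_demazure i f).choose

theorem demazureFun_spec (i : B) (f : SymmetricAlgebra K V) :
    f - symAct H.ρ (cs.simple i) f = SymmetricAlgebra.ι K V (H.root i) * H.demazureFun i f :=
  (H.exists_demazure i f).choose_spec

theorem demazureFun_eq (i : B) {f g : SymmetricAlgebra K V}
    (h : f - symAct H.ρ (cs.simple i) f = SymmetricAlgebra.ι K V (H.root i) * g) :
    H.demazureFun i f = g := by
  rw [demazureFun_spec] at h
  exact mul_left_cancel₀ (ι_ne_zero (H.root_ne_zero i)) h

/-- The Demazure operator, as a linear map over the invariants. -/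
def demazure (i : B) :
    SymmetricAlgebra K V →ₗ[fixed (symAct H.ρ (cs.simple i))] SymmetricAlgebra K V where
  toFun := H.demazureFun i
  map_add' f g := H.demazureFun_eq i (by
    rw [mul_add, ← demazureFun_spec, ← demazureFun_spec, map_add]; ring)
  map_smul' k f := H.demazureFun_eq i (by
    obtain ⟨k, hk⟩ := k
    have hk : symAct H.ρ (cs.simple i) k = k := hk
    change k * f - symAct H.ρ (cs.simple i) (k * f) = SymmetricAlgebra.ι K V (H.root i) *
      (k * H.demazureFun i f)
    rw [map_mul, hk]
    linear_combination k * H.demazureFun_spec i f)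

theorem exists_δ (i : B) : ∃ v, H.coroot i v = 1 := H.coroot_surjective i 1

theorem act_root (i : B) : symAct H.ρ (cs.simple i) (SymmetricAlgebra.ι K V (H.root i)) =
    - SymmetricAlgebra.ι K V (H.root i) := by
  rw [symAct_simple_ι, H.coroot_root, two_smul]; abel

theorem demazure_mem (i : B) (f : SymmetricAlgebra K V) :
    H.demazure i f ∈ fixed (symAct H.ρ (cs.simple i)) := by
  change symAct H.ρ (cs.simple i) (H.demazureFun i f) = H.demazureFun i f
  symm
  refine H.demazureFun_eq i ?_
  have := congrArg (symAct H.ρ (cs.simple i)) (H.demazureFun_spec i f)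
  rw [map_sub, symAct_invol, map_mul, act_root] at this
  linear_combination -this

theorem symAct_mem (g : W) (n : ℤ) (f) (hf : f ∈ symGrade K V n) :
    symAct H.ρ g f ∈ symGrade K V n := by
  induction hf using Submodule.span_induction with
  | mem f hf =>
    obtain ⟨l, hl, rfl⟩ := hf
    rw [map_list_prod, List.map_map]
    have : (symAct H.ρ g ∘ SymmetricAlgebra.ι K V : V → _) =
      SymmetricAlgebra.ι K V ∘ H.ρ g := funext fun v ↦ H.symAct_ι g v
    rw [this, ← List.map_map]
    exact prod_mem_symGrade K V _ (by simpa using hl)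
  | zero => rw [map_zero]; exact zero_mem _
  | add x y _ _ hx hy => rw [map_add]; exact add_mem hx hy
  | smul k x _ hx => rw [map_smul]; exact Submodule.smul_mem _ k hx

theorem demazure_grade (i : B) (n : ℤ) (f) (hf : f ∈ symGrade K V n) :
    H.demazure i f ∈ symGrade K V (n - 2) := by
  obtain ⟨g, hg, h⟩ := H.exists_demazure_homog i n f hf
  have h2 : H.demazure i f = g := H.demazureFun_eq i h
  rw [h2]
  exact hg

/-- The decomposition `R = R ^ s ⊕ δ R ^ s`. -/
def splitData (i : B) : SplitData (symAct H.ρ (cs.simple i)) (symGrade K V) where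
  δ := SymmetricAlgebra.ι K V (H.exists_δ i).choose
  c := LinearMap.id - LinearMap.mulLeft _ (SymmetricAlgebra.ι K V (H.exists_δ i).choose) ∘ₗ H.demazure i
  d := H.demazure i
  c_mem f := by
    have h1 : symAct H.ρ (cs.simple i) (H.demazure i f) = H.demazure i f := H.demazure_mem i f
    have h2 := H.demazureFun_spec i f
    change symAct H.ρ (cs.simple i) (f - SymmetricAlgebra.ι K V (H.exists_δ i).choose *
      H.demazure i f) = f - SymmetricAlgebra.ι K V (H.exists_δ i).choose * H.demazure i f
    rw [map_sub, map_mul, h1, symAct_simple_ι, (H.exists_δ i).choose_spec, one_smul]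
    change _ = SymmetricAlgebra.ι K V (H.root i) * H.demazure i f at h2
    linear_combination -h2
  d_mem := H.demazure_mem i
  eq_add f := (sub_add_cancel f _).symm
  c_one := by
    have : H.demazure i 1 = 0 := H.demazureFun_eq i (by simp)
    simp [this]
  d_one := H.demazureFun_eq i (by simp)
  c_δ := by
    have : H.demazure i (SymmetricAlgebra.ι K V (H.exists_δ i).choose) = 1 :=
      H.demazureFun_eq i (by rw [symAct_simple_ι, (H.exists_δ i).choose_spec]; simp)
    simp [this]
  d_δ := H.demazureFun_eq i (by rw [symAct_simple_ι, (H.exists_δ i).choose_spec]; simp)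
  invol := H.symAct_invol i
  δ_mem := ι_mem_symGrade K V _
  c_grade n f hf := by
    refine sub_mem hf ?_
    have := mul_mem_symGrade K V _ _ _ (ι_mem_symGrade K V (H.exists_δ i).choose) _
      (H.demazure_grade i n f hf)
    rwa [add_sub_cancel] at this
  d_grade n f hf := by
    have := H.demazure_grade i _ f hf
    rwa [show n + 1 - 2 = n - 1 by ring] at this
  ne_zero := by
    rw [symAct_simple_ι, (H.exists_δ i).choose_spec, one_smul, sub_sub_cancel]
    exact ι_ne_zero (H.root_ne_zero i)

/-- `B_s`, for a simple reflection `s`. -/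
def bs (i : B) : DecBimod K (SymmetricAlgebra K V) W :=
  Bs (symAct H.ρ) (symGrade K V) (cs.simple i)

/-- `B_x = B_{s_1} ⊗ ⋯ ⊗ B_{s_l}` for `x = (s_1, …, s_l)`. -/
def bsWord : List B → DecBimod K (SymmetricAlgebra K V) W
  | [] => DecBimod.unit W (symGrade K V)
  | i :: l => (H.bs i).tensor (bsWord l)

theorem bsWord_isC : ∀ l : List B, (H.bsWord l).IsC (symAct H.ρ) (symGrade K V)
  | [] => unit_isC (symGrade_indep K V) (symGrade_iSup K V) (mul_mem_symGrade K V)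
  | i :: l => (H.splitData i).tensor_isC _ (bsWord_isC l) (mul_mem_symGrade K V)
      (one_mem_symGrade K V)

/-- `B_x` as an object of `C`. -/
def BS (l : List B) : ObjC (symAct H.ρ) (symGrade K V) := ⟨H.bsWord l, H.bsWord_isC l⟩

/-- The element `u_x = (1 ⊗ 1) ⊗ ⋯ ⊗ (1 ⊗ 1)` of `B_x`. -/
def u : (l : List B) → (H.BS l).carrier
  | [] => (1 : SymmetricAlgebra K V)
  | i :: l => (show (H.bs i).Right from
      ((1 : SymmetricAlgebra K V) ⊗ₜ[fixed (symAct H.ρ (cs.simple i))] (1 : SymmetricAlgebra K V)))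
        ⊗ₜ[SymmetricAlgebra K V] (show (H.bsWord l).Left from u l)

/-- The coroot `α_t^∨ = w(α_s^∨)` of a reflection `t = w s w⁻¹`, where `(w, s) = c t` is the chosen
presentation of `t`. -/
def reflectionCoroot (c : W → W × B) (t : W) : Module.Dual K V :=
  H.ρ.dual (c t).1 (H.coroot (c t).2)

end Realization

/-- The word `(i, j, i, …)` of length `n`. -/
def alternating {B : Type*} (i j : B) : ℕ → List B
  | 0 => []
  | n + 1 => i :: alternating j i n

end Realization

end

end Soergel

/-! Let `E` be the bimodule of functions from the integers to `Q`, on which `R` acts on the right by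
multiplication and on the left, at `n`, through the inverse of the element `w_n` of the dihedral
group `⟨s, t⟩`. The integers index the infinite dihedral group covering this one: `s` and `t` act on
them as `n ↦ 1 - n` and `n ↦ -1 - n`, and `w_n` has period `2m`. The Demazure operators `∂_s` and
`∂_t` act on `E`, commute with the right action and obey a twisted Leibniz rule for the left action.
Hence every word `x` in `s, t` gives a bimodule map `B_x → E` (`wordHom`); it sends `u_x` to the
composite of the operators of `x`, applied to the delta function at `0`. Write `D` for this value
when `x = (s, t, s, …)` has length `m`. The morphism sends `b` to `a u_y`, where `a ∈ R ⊗ R` is such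
that the image of `b` in `E` is `a D`. Two facts make this possible.

Such an `a` exists. As `∂_s² = ∂_t² = 0`, the image of `B_x` lies in the left span of the functions
attached to alternating words of length at most `m` (`wordHom_mem_demazureSpan`). A Chevalley
formula (`right_demazureWord`) expresses the difference of the right action of `v` and the left
action of `w(v)` on the function of an alternating word, `w` being the product of the word, through
the two alternating words that are shorter by one letter. The coefficients are the values at `v` of
two coroots. Up to length `m` these belong to distinct reflections, so by hypothesis `v` can be
chosen to isolate either shorter word. Descending from `D`, one reaches all of them
(`demazureWord_mem_gen`).

The result does not depend on `a`. The function `D` vanishes nowhere on `-m < n ≤ m`, which is a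
full period (`demazureWord_ne_zero`). So `a D = 0` implies that all evaluations `f ⊗ g ↦ w_n⁻¹(f) g`
kill `a`, and such an `a` kills `u_z` for every word `z` in `s, t` (`act_u_eq_zero`).

The degree is zero because `a` can be chosen homogeneous. Compatibility with the decompositions is
automatic: `⟨s, t⟩` acts faithfully on `V`, so the summands of `B_y ⊗ Q` at its elements are full
eigenspaces (`Separated.onLoc_mem_stalk`). -/

namespace Soergel

noncomputable section

/-! ### The action of `R ⊗ R` on a bimodule, and maps out of `B_s ⊗ M`. -/

section BimoduleAction

variable {K : Type u} [CommRing K] {R : Type w} [CommRing R] [Algebra K R]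

/-- The map `a ↦ a m`, where `R ⊗ R` acts on bimodules by `(f ⊗ g) m = f m g`. -/
def Bimod.act (M : Bimod K R) (m : M.carrier) : R ⊗[K] R →ₗ[K] M.carrier :=
  TensorProduct.lift (LinearMap.mk₂ K (fun f g ↦ M.left f (M.right g m))
    (fun f f' g ↦ by rw [map_add]; rfl)
    (fun k f g ↦ by rw [map_smul]; rfl)
    (fun f g g' ↦ by rw [map_add, LinearMap.add_apply, map_add])
    (fun k f g ↦ by rw [map_smul, LinearMap.smul_apply, map_smul]))

theorem Bimod.act_tmul (M : Bimod K R) (m : M.carrier) (f g : R) :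
    M.act m (f ⊗ₜ g) = M.left f (M.right g m) := rfl

theorem Bimod.act_one (M : Bimod K R) (m : M.carrier) : M.act m 1 = m := by
  rw [Algebra.TensorProduct.one_def, act_tmul, map_one, map_one]; rfl

theorem Bimod.act_left (M : Bimod K R) (m : M.carrier) (f : R) (a : R ⊗[K] R) :
    M.act m ((f ⊗ₜ 1) * a) = M.left f (M.act m a) := by
  induction a with
  | zero => simp
  | add a b ha hb => rw [mul_add, map_add, map_add, ha, hb, map_add]
  | tmul f' g =>
    rw [Algebra.TensorProduct.tmul_mul_tmul, one_mul, act_tmul, act_tmul, map_mul]; rfl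

theorem Bimod.act_right (M : Bimod K R) (m : M.carrier) (g : R) (a : R ⊗[K] R) :
    M.act m ((1 ⊗ₜ g) * a) = M.right g (M.act m a) := by
  induction a with
  | zero => simp
  | add a b ha hb => rw [mul_add, map_add, map_add, ha, hb, map_add]
  | tmul f g' =>
    rw [Algebra.TensorProduct.tmul_mul_tmul, one_mul, act_tmul, act_tmul, map_mul,
      ← M.left_right]; rfl

/-- The degree `n` part of `R ⊗ R`. -/
def tensorGrade (𝒢 : ℤ → Submodule K R) (n : ℤ) : Submodule K (R ⊗[K] R) :=
  Submodule.span K {a | ∃ i j : ℤ, ∃ f ∈ 𝒢 i, ∃ g ∈ 𝒢 j, i + j = n ∧ a = f ⊗ₜ g}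

theorem tmul_mul_mem_tensorGrade {𝒢 : ℤ → Submodule K R}
    (h𝒢 : ∀ i j, ∀ a ∈ 𝒢 i, ∀ b ∈ 𝒢 j, a * b ∈ 𝒢 (i + j)) {i j n k : ℤ} {f g : R}
    (hf : f ∈ 𝒢 i) (hg : g ∈ 𝒢 j) {a : R ⊗[K] R} (ha : a ∈ tensorGrade 𝒢 n)
    (hk : i + j + n = k) : (f ⊗ₜ g) * a ∈ tensorGrade 𝒢 k := by
  induction ha using Submodule.span_induction with
  | mem a ha =>
    obtain ⟨i', j', f', hf', g', hg', rfl, rfl⟩ := ha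
    rw [Algebra.TensorProduct.tmul_mul_tmul]
    exact Submodule.subset_span
      ⟨i + i', j + j', _, h𝒢 _ _ _ hf _ hf', _, h𝒢 _ _ _ hg _ hg', by omega, rfl⟩
  | zero => rw [mul_zero]; exact zero_mem _
  | add x y _ _ hx hy => rw [mul_add]; exact add_mem hx hy
  | smul c x _ hx => rw [mul_smul_comm]; exact Submodule.smul_mem _ _ hx

variable {W : Type x} [Group W]

theorem act_mem_grade {σ : W →* (R →ₐ[K] R)} {𝒢 : ℤ → Submodule K R} {M : DecBimod K R W}
    (hM : M.IsCPrime σ 𝒢) {d : ℤ} {m : M.carrier} (hm : m ∈ M.grade d) {n : ℤ} {a : R ⊗[K] R}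
    (ha : a ∈ tensorGrade 𝒢 n) : M.act m a ∈ M.grade (n + d) := by
  induction ha using Submodule.span_induction with
  | mem a ha =>
    obtain ⟨i', j', f', hf', g', hg', rfl, rfl⟩ := ha
    have := hM.left_mem _ _ _ _ hf' (hM.right_mem _ _ _ _ hg' hm)
    rwa [show i' + (d + j') = i' + j' + d by ring] at this
  | zero => rw [map_zero]; exact zero_mem _
  | add x y _ _ hx hy => rw [map_add]; exact add_mem hx hy
  | smul c x _ hx => rw [map_smul]; exact Submodule.smul_mem _ _ hx

variable {σ : W →* (R →ₐ[K] R)} {𝒢 : ℤ → Submodule K R} {s : W}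

namespace SplitData

/-- The linear map `B_s ⊗ M → E` sending `(f ⊗ g) ⊗ m` to `f ∂(g N(m))`. -/
def liftLin (D : SplitData (σ s) 𝒢) {M : DecBimod K R W} {E : Bimod K R}
    (T : E.carrier →ₗ[K] E.carrier) (N : M.toBimod.Hom E) :
    ((Bs σ 𝒢 s).tensor M).carrier →ₗ[K] E.carrier where
  toFun t := T (N.toLin (coord M D.c t)) + E.left D.δ (T (N.toLin (coord M D.d t)))
  map_add' t t' := by
    have h (c : R →ₗ[fixed (σ s)] R) : (coord (𝒢 := 𝒢) M c (t + t') : M.Right) =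
      coord M c t + coord M c t' := map_add _ _ _
    have h2 (a b : M.Right) : N.toLin (a + b : M.Right) = N.toLin a + N.toLin b :=
      map_add N.toLin a b
    rw [h, h, h2, h2, map_add, map_add, map_add]
    abel
  map_smul' k t := by
    have h (c : R →ₗ[fixed (σ s)] R) : (coord (𝒢 := 𝒢) M c (k • t) : M.Right) =
      k • coord M c t := (coord M c).map_smul_of_tower k (show ((Bs σ 𝒢 s).tensor M).Right from t)
    have h2 (a : M.Right) : N.toLin (k • a : M.Right) = k • N.toLin a :=
      map_smul N.toLin k a
    rw [h, h, h2, h2, map_smul, map_smul, map_smul, smul_add]; rfl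

/-- The invariants `c(f)` and `d(f)` pass through `T`, after which `f = c(f) + δ d(f)` reassembles
the left factor. In particular the map does not depend on the choice of `δ`. -/
theorem liftLin_tm (D : SplitData (σ s) 𝒢) {M : DecBimod K R W} {E : Bimod K R}
    (T : E.carrier →ₗ[K] E.carrier)
    (hl : ∀ k ∈ fixed (σ s), ∀ e, T (E.left k e) = E.left k (T e))
    (N : M.toBimod.Hom E) (f g : R) (m : M.carrier) :
    D.liftLin T N (tm M f g m) = E.left f (T (E.left g (N.toLin m))) := by
  have h (k : R) : N.toLin (M.leftMul k m) = E.left k (N.toLin m) := N.map_left k m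
  change T (N.toLin (M.leftMul (D.c f * g) m)) +
    E.left D.δ (T (N.toLin (M.leftMul (D.d f * g) m))) = _
  rw [h, h, map_mul, map_mul, Module.End.mul_apply, Module.End.mul_apply, hl _ (D.c_mem f),
    hl _ (D.d_mem f), ← Module.End.mul_apply (E.left D.δ), ← map_mul, ← LinearMap.add_apply,
    ← map_add, ← D.eq_add]

/-- The homomorphism `B_s ⊗ M → E` sending `(f ⊗ g) ⊗ m` to `f ∂(g N(m))`. -/
def liftHom (D : SplitData (σ s) 𝒢) {M : DecBimod K R W} {E : Bimod K R}
    (T : E.carrier →ₗ[K] E.carrier)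
    (hl : ∀ k ∈ fixed (σ s), ∀ e, T (E.left k e) = E.left k (T e))
    (hr : ∀ k e, T (E.right k e) = E.right k (T e)) (N : M.toBimod.Hom E) :
    ((Bs σ 𝒢 s).tensor M).toBimod.Hom E where
  toLin := D.liftLin T N
  map_left a := by
    refine tm_ind (P := fun t ↦ D.liftLin T N (((Bs σ 𝒢 s).tensor M).left a t) =
      E.left a (D.liftLin T N t)) M ?_ ?_ ?_
    · exact ((congrArg _ (map_zero _)).trans (map_zero _)).trans
        ((congrArg _ (map_zero _)).trans (map_zero _)).symm
    · intro x y hx hy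
      have h : D.liftLin T N (((Bs σ 𝒢 s).tensor M).left a (x + y)) =
        D.liftLin T N (((Bs σ 𝒢 s).tensor M).left a x) +
          D.liftLin T N (((Bs σ 𝒢 s).tensor M).left a y) :=
        (congrArg _ (map_add _ _ _)).trans (map_add _ _ _)
      rw [h, hx, hy, ← map_add]
      exact congrArg _ (map_add (D.liftLin T N) x y).symm
    · intro f g m
      have h : ((Bs σ 𝒢 s).tensor M).left a (tm M f g m) = tm M (a * f) g m :=
        congrArg (fun b ↦ tn M b m) (left_bt a f g)
      refine (congrArg (D.liftLin T N) h).trans ((D.liftLin_tm T hl N (a * f) g m).trans ?_)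
      rw [map_mul, Module.End.mul_apply]
      exact congrArg (E.left a) (D.liftLin_tm T hl N f g m).symm
  map_right a t := by
    have h (c : R →ₗ[fixed (σ s)] R) : N.toLin (coord (𝒢 := 𝒢) M c
        (((Bs σ 𝒢 s).tensor M).right a t)) = E.right a (N.toLin (coord M c t)) :=
      (congrArg N.toLin ((coord (𝒢 := 𝒢) M c).map_smul a t)).trans (N.map_right a _)
    change T (N.toLin _) + E.left D.δ (T (N.toLin _)) =
      E.right a (T (N.toLin _) + E.left D.δ (T (N.toLin _)))
    rw [h, h, hr, hr, map_add, E.left_right]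

end SplitData

end BimoduleAction

/-! ### Homomorphisms defined through a cyclic `R ⊗ R`-module. -/

section FactorThrough

variable {K : Type u} [CommRing K] {R : Type w} [CommRing R] [Algebra K R]

/-- If every element of the image of `N : M → E` is of the form `a e`, with `a ∈ R ⊗ R`, and
`a e = 0` implies `a n = 0`, there is a homomorphism `M → M'` which sends `m` to `a n` if
`N(m) = a e`. -/
theorem Bimod.exists_hom_of_act {M M' E : Bimod K R} (N : M.Hom E) (e : E.carrier)
    (n : M'.carrier) (h1 : ∀ m, ∃ a, E.act e a = N.toLin m)
    (h2 : ∀ a, E.act e a = 0 → M'.act n a = 0) :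
    ∃ φ : M.Hom M', ∀ m a, E.act e a = N.toLin m → φ.toLin m = M'.act n a := by
  choose F hF using h1
  -- The preimages `F m` are arbitrary choices. That the outcome depends only on `E.act e a` is what
  -- makes the resulting map linear and compatible with both actions.
  have key {a b} (h : E.act e a = E.act e b) : M'.act n a = M'.act n b := by
    rw [← sub_eq_zero, ← map_sub] at h ⊢
    exact h2 _ h
  refine ⟨{ toLin :=
              { toFun := fun m ↦ M'.act n (F m)
                map_add' := fun x y ↦ ?_
                map_smul' := fun k x ↦ ?_ }
            map_left := fun a m ↦ ?_
            map_right := fun a m ↦ ?_ }, fun m a h ↦ key ((hF m).trans h.symm)⟩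
  · rw [← map_add]
    exact key (by rw [hF, map_add, map_add, hF, hF])
  · rw [← map_smul]
    exact key (by rw [hF, map_smul, map_smul, hF]; rfl)
  · change M'.act n (F _) = M'.left a (M'.act n (F m))
    rw [← Bimod.act_left]
    exact key (by rw [hF, Bimod.act_left, hF, N.map_left])
  · change M'.act n (F _) = M'.right a (M'.act n (F m))
    rw [← Bimod.act_right]
    exact key (by rw [hF, Bimod.act_right, hF, N.map_right])

end FactorThrough

/-! ### Summands of `M_Q` as eigenspaces. -/

section Stalks

variable {K : Type u} [CommRing K] {R : Type w} [CommRing R] [Algebra K R]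
variable {W : Type x} [Group W] {σ : W →* (R →ₐ[K] R)} {𝒢 : ℤ → Submodule K R}

/-- The component of `z` at some `h ≠ g` is killed by left multiplication by `σ h f - σ g f`. For a
suitable `f` this is nonzero, and left multiplication by a nonzero element is injective on `M_Q`, so
the component vanishes. -/
theorem DecBimod.IsCPrime.mem_stalk_of_eigen [IsDomain R] {M : DecBimod K R W}
    (hM : M.IsCPrime σ 𝒢) {g : W} (hg : ∀ h, M.stalk h ≠ ⊥ → h ≠ g → ∃ f, σ h f ≠ σ g f)
    {z : M.loc} (hz : z ∈ M.toBimod.eigen (σ g)) : z ∈ M.stalk g := by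
  obtain ⟨y, hy, rfl⟩ :=
    (Submodule.mem_iSup_iff_exists_finsupp M.stalk z).1 (hM.stalk_iSup ▸ Submodule.mem_top)
  refine Submodule.sum_mem _ fun h hh ↦ ?_
  obtain rfl | hne := eq_or_ne h g
  · exact hy h
  by_cases hb : M.stalk h = ⊥
  · have : y h = 0 := by simpa [hb] using hy h
    rw [this]; exact zero_mem _
  obtain ⟨f, hf⟩ := hg h hb hne
  exfalso
  have h1 := hz f
  rw [← sub_eq_zero, Finsupp.sum, Finset.smul_sum, map_sum, ← Finset.sum_sub_distrib] at h1
  have h3 (k : W) (hk : k ∈ y.support) : algebraMap R (FractionRing R) f • y k -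
      M.leftLoc (σ g f) (y k) ∈ M.stalk k :=
    sub_mem (Submodule.smul_mem _ _ (hy k)) (hM.left_mem_stalk k _ (hy k))
  have h2 := (iSupIndep_iff_finsetSum_eq_zero_imp_eq_zero M.stalk).1 hM.stalk_indep y.support _
    h3 h1 h hh
  rw [hM.stalk_smul h f _ (hy h), ← LinearMap.sub_apply] at h2
  have h4 : M.leftLoc (σ h f - σ g f) (y h) = 0 := by
    rw [sub_eq_add_neg, Bimod.leftLoc_add, Bimod.leftLoc_neg, ← sub_eq_add_neg]
    exact h2
  exact (Finsupp.mem_support_iff.1 hh) (hM.left_injective (sub_ne_zero.2 hf) _ h4)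

theorem Bimod.Hom.onLoc_mem_eigen {M N : Bimod K R} (φ : M.Hom N) {h : R →ₐ[K] R} {z : M.loc}
    (hz : z ∈ M.eigen h) : φ.onLoc z ∈ N.eigen h := by
  intro f
  rw [← map_smul, hz f]
  change (φ.onRight.baseChange (FractionRing R) ∘ₗ (M.leftMul (h f)).baseChange (FractionRing R)) z =
    ((N.leftMul (h f)).baseChange (FractionRing R) ∘ₗ φ.onRight.baseChange (FractionRing R)) z
  rw [← LinearMap.baseChange_comp, ← LinearMap.baseChange_comp]
  congr 2
  ext m
  exact φ.map_left _ m

end Stalks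

/-! ### Dihedral elements indexed by the integers. -/

section DihedralElements

variable {B : Type*} {W : Type x} [Group W] {M : CoxeterMatrix B} (cs : CoxeterSystem M W)
  (p : ℤˣ → B)

/-- The elements of the subgroup generated by two simple reflections `s_1` and `s_{-1}`, indexed
by integers in such a way that `s_ε` interchanges the elements number `n` and `ε - n`. The element
number `ε k` is the alternating word of length `k` which starts with `s_ε`. -/
def dihedralElt (n : ℤ) : W :=
  if Even n then (cs.simple (p 1) * cs.simple (p (-1))) ^ (n / 2)
  else (cs.simple (p 1) * cs.simple (p (-1))) ^ (n / 2) * cs.simple (p 1)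

theorem dihedralElt_two_mul (k : ℤ) :
    dihedralElt cs p (2 * k) = (cs.simple (p 1) * cs.simple (p (-1))) ^ k := by
  rw [dihedralElt, if_pos (even_two_mul k), Int.mul_ediv_cancel_left _ two_ne_zero]

theorem dihedralElt_two_mul_add_one (k : ℤ) : dihedralElt cs p (2 * k + 1) =
    (cs.simple (p 1) * cs.simple (p (-1))) ^ k * cs.simple (p 1) := by
  rw [dihedralElt, if_neg (by simp), show (2 * k + 1) / 2 = k by omega]

theorem dihedralElt_zero : dihedralElt cs p 0 = 1 := by
  simpa using dihedralElt_two_mul cs p 0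

theorem simple_mul_zpow (k : ℤ) :
    cs.simple (p 1) * (cs.simple (p 1) * cs.simple (p (-1))) ^ k =
      (cs.simple (p 1) * cs.simple (p (-1))) ^ (-k) * cs.simple (p 1) := by
  have h : MulAut.conj (cs.simple (p 1)) (cs.simple (p 1) * cs.simple (p (-1))) =
      (cs.simple (p 1) * cs.simple (p (-1)))⁻¹ := by
    simp [MulAut.conj_apply]
  have h2 := map_zpow (MulAut.conj (cs.simple (p 1))) (cs.simple (p 1) * cs.simple (p (-1))) k
  rw [h, inv_zpow', MulAut.conj_apply] at h2
  rw [← h2, inv_mul_cancel_right]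

theorem simple_neg_one_mul_zpow (k : ℤ) :
    cs.simple (p (-1)) * (cs.simple (p 1) * cs.simple (p (-1))) ^ k =
      (cs.simple (p 1) * cs.simple (p (-1))) ^ (-1 - k) * cs.simple (p 1) := by
  rw [sub_eq_add_neg, zpow_add, mul_assoc, ← simple_mul_zpow, ← mul_assoc]
  simp

theorem simple_mul_dihedralElt (ε : ℤˣ) (n : ℤ) :
    cs.simple (p ε) * dihedralElt cs p n = dihedralElt cs p (ε - n) := by
  obtain ⟨k, rfl | rfl⟩ := Int.even_or_odd' n
  · rw [dihedralElt_two_mul]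
    obtain rfl | rfl := Int.units_eq_one_or ε
    · rw [simple_mul_zpow, ← dihedralElt_two_mul_add_one]
      congr 1; push_cast; ring
    · rw [simple_neg_one_mul_zpow, ← dihedralElt_two_mul_add_one]
      congr 1; push_cast; ring
  · rw [dihedralElt_two_mul_add_one, ← mul_assoc]
    obtain rfl | rfl := Int.units_eq_one_or ε
    · rw [simple_mul_zpow, cs.simple_mul_simple_cancel_right, ← dihedralElt_two_mul]
      congr 1; push_cast; ring
    · rw [simple_neg_one_mul_zpow, cs.simple_mul_simple_cancel_right, ← dihedralElt_two_mul]
      congr 1; push_cast; ring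

theorem dihedralElt_add_two_mul (n k : ℤ) : dihedralElt cs p (n + 2 * k) =
    (cs.simple (p 1) * cs.simple (p (-1))) ^ k * dihedralElt cs p n := by
  obtain ⟨l, rfl | rfl⟩ := Int.even_or_odd' n
  · rw [← mul_add, dihedralElt_two_mul, dihedralElt_two_mul, ← zpow_add, add_comm]
  · rw [show 2 * l + 1 + 2 * k = 2 * (k + l) + 1 by ring, dihedralElt_two_mul_add_one,
      dihedralElt_two_mul_add_one, zpow_add, mul_assoc]

theorem dihedralElt_add_two_mul_eq_iff (n k : ℤ) :
    dihedralElt cs p (n + 2 * k) = dihedralElt cs p n ↔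
      (orderOf (cs.simple (p 1) * cs.simple (p (-1))) : ℤ) ∣ k := by
  rw [dihedralElt_add_two_mul, mul_eq_right, orderOf_dvd_iff_zpow_eq_one]

/-- Left multiplication by powers of `s_1 s_{-1}` shifts the index by even integers and commutes
with right multiplication, so the latter is a shift that depends only on the parity of the index. -/
theorem dihedralElt_mul_simple_of_even (ε : ℤˣ) {n : ℤ} (hn : Even n) :
    dihedralElt cs p n * cs.simple (p ε) = dihedralElt cs p (n + ε) := by
  obtain ⟨k, rfl⟩ := hn
  rw [← two_mul, add_comm, dihedralElt_add_two_mul, dihedralElt_two_mul]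
  congr 1
  have := simple_mul_dihedralElt cs p ε 0
  rwa [dihedralElt_zero, mul_one, sub_zero] at this

theorem dihedralElt_mul_simple_of_odd (ε : ℤˣ) {n : ℤ} (hn : Odd n) :
    dihedralElt cs p n * cs.simple (p ε) = dihedralElt cs p (n - ε) := by
  have h : Even (n - ε) := by
    obtain rfl | rfl := Int.units_eq_one_or ε
    · simpa [Int.even_sub, Int.odd_iff] using hn
    · obtain ⟨k, rfl⟩ := hn
      exact ⟨k + 1, by push_cast; ring⟩
  have := dihedralElt_mul_simple_of_even cs p ε h
  rw [sub_add_cancel] at this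
  rw [← this, cs.simple_mul_simple_cancel_right]

theorem simple_mem_closure (ε : ℤˣ) :
    cs.simple (p ε) ∈ Subgroup.closure {cs.simple (p 1), cs.simple (p (-1))} := by
  obtain rfl | rfl := Int.units_eq_one_or ε
  · exact Subgroup.subset_closure (Set.mem_insert _ _)
  · exact Subgroup.subset_closure (Set.mem_insert_of_mem _ rfl)

theorem dihedralElt_mem_closure (n : ℤ) : dihedralElt cs p n ∈
    Subgroup.closure {cs.simple (p 1), cs.simple (p (-1))} := by
  have h := Subgroup.zpow_mem _
    (mul_mem (simple_mem_closure cs p 1) (simple_mem_closure cs p (-1))) (n / 2)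
  rw [dihedralElt]
  split_ifs
  · exact h
  · exact mul_mem h (simple_mem_closure cs p 1)

/-- Conjugating `s_ε` by the rotation number `2l` gives the element number `4l + ε`, and every odd
integer has this form. -/
theorem exists_dihedralElt_eq_conj {n : ℤ} (hn : Odd n) : ∃ ε : ℤˣ, ∃ k : ℤ, dihedralElt cs p n =
    dihedralElt cs p k * cs.simple (p ε) * (dihedralElt cs p k)⁻¹ := by
  have h (ε : ℤˣ) (l : ℤ) : dihedralElt cs p (2 * l) * cs.simple (p ε) *
      (dihedralElt cs p (2 * l))⁻¹ = dihedralElt cs p (4 * l + ε) := by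
    rw [mul_inv_eq_iff_eq_mul, dihedralElt_mul_simple_of_even cs p ε (even_two_mul l)]
    have h2 : dihedralElt cs p (ε : ℤ) = cs.simple (p ε) := by
      have := simple_mul_dihedralElt cs p ε 0
      rwa [dihedralElt_zero, mul_one, sub_zero, eq_comm] at this
    rw [show 4 * l + (ε : ℤ) = ε + 2 * (2 * l) by ring, dihedralElt_add_two_mul, h2, mul_assoc,
      simple_mul_dihedralElt, ← dihedralElt_add_two_mul]
    congr 1; ring
  obtain ⟨l, hl⟩ : ∃ l, n = 4 * l + 1 ∨ n = 4 * l - 1 := by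
    obtain ⟨k, rfl⟩ := hn
    exact ⟨(k + 1) / 2, by omega⟩
  obtain rfl | rfl := hl
  · exact ⟨1, 2 * l, (h 1 l).symm⟩
  · exact ⟨-1, 2 * l, (h (-1) l).symm⟩

end DihedralElements

/-! ### Coroots of reflections and faithfulness of the dihedral action. -/

namespace Realization

variable {B : Type*} {W : Type x} [Group W] {M : CoxeterMatrix B}
variable {cs : CoxeterSystem M W} {K : Type u} [CommRing K] {V : Type v} [AddCommGroup V]
  [Module K V] (H : Realization cs K V)

theorem conj_apply (g : W) (i : B) (v : V) : H.ρ (g * cs.simple i * g⁻¹) v =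
    v - H.coroot i (H.ρ g⁻¹ v) • H.ρ g (H.root i) := by
  rw [map_mul, map_mul, Module.End.mul_apply, Module.End.mul_apply, H.simple_apply, map_sub,
    map_smul, ← Module.End.mul_apply, ← map_mul, mul_inv_cancel, map_one]; rfl

theorem ρ_inv_apply (g : W) (v : V) : H.ρ g⁻¹ (H.ρ g v) = v := by
  rw [← Module.End.mul_apply, ← map_mul, inv_mul_cancel, map_one]; rfl

theorem ρ_root_ne_zero (g : W) (i : B) : H.ρ g (H.root i) ≠ 0 := fun h ↦
  H.root_ne_zero i (by rw [← H.ρ_inv_apply g (H.root i), h, map_zero])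

theorem exists_conj_coroot_eq_one (g : W) (i : B) : ∃ v, H.coroot i (H.ρ g⁻¹ v) = 1 := by
  obtain ⟨v, hv⟩ := H.coroot_surjective i 1
  exact ⟨H.ρ g v, by rw [H.ρ_inv_apply, hv]⟩

/-- Both sides are `v - t(v)` for the common reflection `t`: although root and coroot depend on the
presentation of `t`, this rank-one map does not. -/
theorem coroot_smul_root_eq {g g' : W} {i i' : B}
    (h : g * cs.simple i * g⁻¹ = g' * cs.simple i' * g'⁻¹) (v : V) :
    H.coroot i (H.ρ g⁻¹ v) • H.ρ g (H.root i) = H.coroot i' (H.ρ g'⁻¹ v) • H.ρ g' (H.root i') := by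
  have := H.conj_apply g i v
  rw [h, H.conj_apply] at this
  exact (sub_right_injective this).symm

variable [IsDomain K] [Module.Free K V]

theorem coroot_eq_zero_of_conj_eq {g g' : W} {i i' : B}
    (h : g * cs.simple i * g⁻¹ = g' * cs.simple i' * g'⁻¹) {v : V}
    (hv : H.coroot i (H.ρ g⁻¹ v) = 0) : H.coroot i' (H.ρ g'⁻¹ v) = 0 := by
  have := H.coroot_smul_root_eq h v
  rw [hv, zero_smul, eq_comm, smul_eq_zero] at this
  exact this.resolve_right (H.ρ_root_ne_zero g' i')

/-- Both coroots take the value `1`, so each of the two roots is a multiple of the other; the two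
factors are inverse to each other because `V` is torsion free. Thus the coroot of a reflection is
well defined up to a unit. -/
theorem isUnit_coroot_of_conj_eq {g g' : W} {i i' : B}
    (h : g * cs.simple i * g⁻¹ = g' * cs.simple i' * g'⁻¹) {v : V}
    (hv : H.coroot i (H.ρ g⁻¹ v) = 1) : ∃ e, e * H.coroot i' (H.ρ g'⁻¹ v) = 1 := by
  obtain ⟨v', hv'⟩ := H.exists_conj_coroot_eq_one g' i'
  have h1 := H.coroot_smul_root_eq h v
  have h2 := H.coroot_smul_root_eq h v'
  rw [hv, one_smul] at h1
  rw [hv', one_smul, h1, smul_smul] at h2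
  refine ⟨H.coroot i (H.ρ g⁻¹ v'), ?_⟩
  have h3 : (H.coroot i (H.ρ g⁻¹ v') * H.coroot i' (H.ρ g'⁻¹ v) - 1) • H.ρ g' (H.root i') = 0 := by
    rw [sub_smul, h2, one_smul, sub_self]
  exact sub_eq_zero.1 ((smul_eq_zero.1 h3).resolve_right (H.ρ_root_ne_zero g' i'))

/-- The pairs of distinct reflections in the subgroup generated by two simple reflections have
coroots which are part of a dual basis. -/
def Separated (p : ℤˣ → B) : Prop :=
  ∀ (g g' : W) (ε ε' : ℤˣ),
    g ∈ Subgroup.closure {cs.simple (p 1), cs.simple (p (-1))} →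
    g' ∈ Subgroup.closure {cs.simple (p 1), cs.simple (p (-1))} →
    g * cs.simple (p ε) * g⁻¹ ≠ g' * cs.simple (p ε') * g'⁻¹ →
    ∃ v, H.coroot (p ε) (H.ρ g⁻¹ v) = 0 ∧ H.coroot (p ε') (H.ρ g'⁻¹ v) = 1

/-- Changing the chosen presentations multiplies coroots by units, so the vector from the hypothesis
only needs rescaling. -/
theorem separated_of_reflectionCoroot (p : ℤˣ → B) (c : W → W × B)
    (hc : ∀ t, cs.IsReflection t → t = (c t).1 * cs.simple (c t).2 * (c t).1⁻¹)
    (h : ∀ t₁ t₂ : W, cs.IsReflection t₁ → cs.IsReflection t₂ →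
        t₁ ∈ Subgroup.closure {cs.simple (p 1), cs.simple (p (-1))} →
        t₂ ∈ Subgroup.closure {cs.simple (p 1), cs.simple (p (-1))} → t₁ ≠ t₂ →
        ∃ v : V, H.reflectionCoroot c t₁ v = 0 ∧ H.reflectionCoroot c t₂ v = 1) :
    H.Separated p := by
  intro g g' ε ε' hg hg' hne
  have hr (g : W) (i : B) : cs.IsReflection (g * cs.simple i * g⁻¹) := ⟨g, i, rfl⟩
  obtain ⟨v, hv, hv'⟩ := h _ _ (hr g (p ε)) (hr g' (p ε'))
    (mul_mem (mul_mem hg (simple_mem_closure cs p ε)) (inv_mem hg))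
    (mul_mem (mul_mem hg' (simple_mem_closure cs p ε')) (inv_mem hg')) hne
  obtain ⟨e, he⟩ := H.isUnit_coroot_of_conj_eq (hc _ (hr g' (p ε'))).symm hv'
  refine ⟨e • v, ?_, ?_⟩
  · rw [map_smul, map_smul, H.coroot_eq_zero_of_conj_eq (hc _ (hr g (p ε))).symm hv, smul_zero]
  · rw [map_smul, map_smul, smul_eq_mul, he]

variable {H} {p : ℤˣ → B}

/-- On a vector where one coroot vanishes and the other is `1`, the first reflection is trivial and
the second subtracts a nonzero root. -/
theorem Separated.exists_ρ_ne_of_odd (h : H.Separated p) {a b : ℤ} (ha : Odd a) (hb : Odd b)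
    (hab : dihedralElt cs p a ≠ dihedralElt cs p b) :
    ∃ v, H.ρ (dihedralElt cs p a) v ≠ H.ρ (dihedralElt cs p b) v := by
  obtain ⟨ε, k, hk⟩ := exists_dihedralElt_eq_conj cs p ha
  obtain ⟨ε', k', hk'⟩ := exists_dihedralElt_eq_conj cs p hb
  rw [hk, hk'] at hab ⊢
  obtain ⟨v, hv, hv'⟩ := h _ _ ε ε' (dihedralElt_mem_closure cs p k)
    (dihedralElt_mem_closure cs p k') hab
  refine ⟨v, fun heq ↦ H.ρ_root_ne_zero (dihedralElt cs p k') (p ε') ?_⟩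
  rw [H.conj_apply, H.conj_apply, hv, hv', zero_smul, one_smul] at heq
  exact (sub_right_injective heq).symm

/-- Two rotations become two reflections after right multiplication by `s_1`. A rotation and a
reflection differ by a reflection, and a reflection moves any vector on which its coroot is `1`.
This argument works in every characteristic. -/
theorem Separated.exists_ρ_ne (h : H.Separated p) {a b : ℤ}
    (hab : dihedralElt cs p a ≠ dihedralElt cs p b) :
    ∃ v, H.ρ (dihedralElt cs p a) v ≠ H.ρ (dihedralElt cs p b) v := by
  have hodd (n : ℤ) (hn : Odd n) : ∃ v, H.ρ (dihedralElt cs p n) v ≠ v := by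
    obtain ⟨ε, k, hk⟩ := exists_dihedralElt_eq_conj cs p hn
    obtain ⟨v, hv⟩ := H.exists_conj_coroot_eq_one (dihedralElt cs p k) (p ε)
    refine ⟨v, fun h ↦ H.ρ_root_ne_zero (dihedralElt cs p k) (p ε) ?_⟩
    rwa [hk, H.conj_apply, hv, one_smul, sub_eq_self] at h
  have mixed (a k : ℤ) (ha : Odd a) : ∃ v, H.ρ (dihedralElt cs p (2 * k)) v ≠
      H.ρ (dihedralElt cs p a) v := by
    obtain ⟨v, hv⟩ := hodd (a + 2 * (-k)) (by simpa [Int.odd_add] using ha)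
    refine ⟨v, fun h ↦ hv ?_⟩
    rw [dihedralElt_add_two_mul, map_mul, Module.End.mul_apply, ← h, dihedralElt_two_mul,
      zpow_neg, H.ρ_inv_apply]
  obtain ⟨k, rfl | rfl⟩ := Int.even_or_odd' a <;> obtain ⟨l, rfl | rfl⟩ := Int.even_or_odd' b
  · have e (k : ℤ) : dihedralElt cs p (2 * k + 1) =
        dihedralElt cs p (2 * k) * cs.simple (p 1) := by
      rw [dihedralElt_two_mul_add_one, dihedralElt_two_mul]
    obtain ⟨v, hv⟩ := h.exists_ρ_ne_of_odd (odd_two_mul_add_one k) (odd_two_mul_add_one l)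
      (by rw [e, e]; simpa using hab)
    rw [e, e, map_mul, map_mul] at hv
    exact ⟨_, hv⟩
  · exact mixed _ k (odd_two_mul_add_one l)
  · obtain ⟨v, hv⟩ := mixed _ l (odd_two_mul_add_one k)
    exact ⟨v, hv.symm⟩
  · exact h.exists_ρ_ne_of_odd (odd_two_mul_add_one k) (odd_two_mul_add_one l) hab

end Realization

/-! ### Demazure operators on functions on the integers, and the Chevalley formula. -/

namespace Realization

variable {B : Type*} {W : Type x} [Group W] {M : CoxeterMatrix B}
variable {cs : CoxeterSystem M W} {K : Type u} [CommRing K] {V : Type v} [AddCommGroup V]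
  [Module K V] (H : Realization cs K V) [IsDomain K] [Module.Free K V] (p : ℤˣ → B)

/-- The functions on the integers with values in the field of fractions `Q` of `R`, where `R` acts
on the left, at the integer `n`, through the inverse of the element number `n` of the dihedral
group. -/
def dihedralBimod : Bimod K (SymmetricAlgebra K V) :=
  Bimod.ofAlgHom (A := ℤ → FractionRing (SymmetricAlgebra K V))
    (AlgHom.pi fun n ↦ (IsScalarTower.toAlgHom K (SymmetricAlgebra K V) _).comp
      (symAct H.ρ (dihedralElt cs p n)⁻¹))
    (AlgHom.pi fun n ↦ IsScalarTower.toAlgHom K (SymmetricAlgebra K V) _)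

theorem dihedralBimod_left (f : SymmetricAlgebra K V) (z : (H.dihedralBimod p).carrier) (n : ℤ) :
    (H.dihedralBimod p).left f z n =
      algebraMap (SymmetricAlgebra K V) (FractionRing (SymmetricAlgebra K V))
        (symAct H.ρ (dihedralElt cs p n)⁻¹ f) * z n := rfl

theorem dihedralBimod_right (f : SymmetricAlgebra K V) (z : (H.dihedralBimod p).carrier) (n : ℤ) :
    (H.dihedralBimod p).right f z n =
      algebraMap (SymmetricAlgebra K V) (FractionRing (SymmetricAlgebra K V)) f * z n := rfl

/-- The root `α_ε`, acted on by the inverse of the element number `n`. -/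
def dihedralRoot (ε : ℤˣ) (n : ℤ) : FractionRing (SymmetricAlgebra K V) :=
  algebraMap (SymmetricAlgebra K V) _ (symAct H.ρ (dihedralElt cs p n)⁻¹
    (SymmetricAlgebra.ι K V (H.root (p ε))))

theorem dihedralRoot_ne_zero (ε : ℤˣ) (n : ℤ) : H.dihedralRoot p ε n ≠ 0 := by
  rw [dihedralRoot, symAct_ι]
  simpa using ι_ne_zero (H.ρ_root_ne_zero _ _)

theorem symAct_dihedralElt_sub (ε : ℤˣ) (n : ℤ) (f : SymmetricAlgebra K V) :
    symAct H.ρ (dihedralElt cs p (ε - n))⁻¹ f =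
      symAct H.ρ (dihedralElt cs p n)⁻¹ (symAct H.ρ (cs.simple (p ε)) f) := by
  rw [← simple_mul_dihedralElt, mul_inv_rev, cs.inv_simple, map_mul, AlgHom.mul_apply]

theorem dihedralRoot_sub (ε : ℤˣ) (n : ℤ) :
    H.dihedralRoot p ε (ε - n) = -H.dihedralRoot p ε n := by
  rw [dihedralRoot, dihedralRoot, symAct_dihedralElt_sub, act_root, map_neg, map_neg]

/-- The Demazure operator on functions on the integers. -/
def dihedralDemazure (ε : ℤˣ) : (H.dihedralBimod p).carrier →ₗ[K] (H.dihedralBimod p).carrier where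
  toFun z := (fun n ↦ (z n - z (ε - n)) / H.dihedralRoot p ε n :
    ℤ → FractionRing (SymmetricAlgebra K V))
  map_add' z z' := funext fun n ↦ by
    change (z n + z' n - (z _ + z' _)) / _ = (z n - z _) / _ + (z' n - z' _) / _
    ring
  map_smul' k z := funext fun n ↦ by
    change (k • z n - k • z _) / _ = k • ((z n - z _) / _)
    rw [← smul_sub, smul_div_assoc]

theorem dihedralDemazure_apply (ε : ℤˣ) (z : (H.dihedralBimod p).carrier) (n : ℤ) :
    H.dihedralDemazure p ε z n = (z n - z (ε - n)) / H.dihedralRoot p ε n := rfl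

theorem dihedralDemazure_self (ε : ℤˣ) (z : (H.dihedralBimod p).carrier) :
    H.dihedralDemazure p ε (H.dihedralDemazure p ε z) = 0 := by
  refine funext fun n ↦ ?_
  rw [dihedralDemazure_apply, dihedralDemazure_apply, dihedralDemazure_apply, dihedralRoot_sub,
    sub_sub_cancel, div_neg, ← neg_div, neg_sub, sub_self, zero_div]
  rfl

theorem dihedralRoot_mul_demazure (ε : ℤˣ) (n : ℤ) (f : SymmetricAlgebra K V) :
    H.dihedralRoot p ε n * algebraMap (SymmetricAlgebra K V) _
      (symAct H.ρ (dihedralElt cs p n)⁻¹ (H.demazure (p ε) f)) =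
    algebraMap (SymmetricAlgebra K V) _ (symAct H.ρ (dihedralElt cs p n)⁻¹ f) -
      algebraMap (SymmetricAlgebra K V) _ (symAct H.ρ (dihedralElt cs p (ε - n))⁻¹ f) := by
  rw [symAct_dihedralElt_sub, ← map_sub, ← map_sub, H.demazureFun_spec, map_mul, map_mul]
  rfl

/-- This is the Leibniz rule. The twist appears because the left action of `f` at `ε - n` is that of
`s_ε(f)` at `n`. -/
theorem dihedralDemazure_left (ε : ℤˣ) (f : SymmetricAlgebra K V)
    (z : (H.dihedralBimod p).carrier) :
    H.dihedralDemazure p ε ((H.dihedralBimod p).left f z) =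
      (H.dihedralBimod p).left (H.demazure (p ε) f) z +
      (H.dihedralBimod p).left (symAct H.ρ (cs.simple (p ε)) f) (H.dihedralDemazure p ε z) := by
  refine funext fun n ↦ ?_
  change H.dihedralDemazure p ε _ n = (H.dihedralBimod p).left (H.demazure (p ε) f) z n +
    (H.dihedralBimod p).left _ (H.dihedralDemazure p ε z) n
  have h := H.dihedralRoot_ne_zero p ε n
  have h2 := H.dihedralRoot_mul_demazure p ε n f
  rw [dihedralDemazure_apply, dihedralBimod_left, dihedralBimod_left, dihedralBimod_left,
    dihedralBimod_left, dihedralDemazure_apply, ← symAct_dihedralElt_sub]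
  field_simp
  linear_combination -(z n) * h2

theorem dihedralDemazure_left_fixed (ε : ℤˣ) (k : SymmetricAlgebra K V)
    (hk : k ∈ fixed (symAct H.ρ (cs.simple (p ε)))) (z : (H.dihedralBimod p).carrier) :
    H.dihedralDemazure p ε ((H.dihedralBimod p).left k z) =
      (H.dihedralBimod p).left k (H.dihedralDemazure p ε z) := by
  have hk' : symAct H.ρ (cs.simple (p ε)) k = k := hk
  have h0 : H.demazure (p ε) k = 0 := H.demazureFun_eq (p ε) (by rw [hk', sub_self, mul_zero])
  rw [dihedralDemazure_left, hk', h0, map_zero, LinearMap.zero_apply, zero_add]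

theorem dihedralDemazure_right (ε : ℤˣ) (k : SymmetricAlgebra K V)
    (z : (H.dihedralBimod p).carrier) :
    H.dihedralDemazure p ε ((H.dihedralBimod p).right k z) =
      (H.dihedralBimod p).right k (H.dihedralDemazure p ε z) := by
  refine funext fun n ↦ ?_
  rw [dihedralDemazure_apply, dihedralBimod_right, dihedralBimod_right, dihedralBimod_right,
    dihedralDemazure_apply]
  ring

/-- The result of the Demazure operators of an alternating word of length `k` which starts
with `ε`, applied to the function which is `1` at zero and vanishes elsewhere. -/
def demazureWord : ℤˣ → ℕ → (H.dihedralBimod p).carrier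
  | _, 0 => (Pi.single 0 1 : ℤ → FractionRing (SymmetricAlgebra K V))
  | ε, k + 1 => H.dihedralDemazure p ε (demazureWord (-ε) k)

theorem demazureWord_succ (ε : ℤˣ) (k : ℕ) :
    H.demazureWord p ε (k + 1) = H.dihedralDemazure p ε (H.demazureWord p (-ε) k) := by
  rw [demazureWord]

theorem demazureWord_zero (ε : ℤˣ) : H.demazureWord p ε 0 =
    (Pi.single 0 1 : ℤ → FractionRing (SymmetricAlgebra K V)) := by
  rw [demazureWord]

theorem demazureWord_apply_eq_zero (k : ℕ) (ε : ℤˣ) (n : ℤ) (hn : k < n.natAbs) :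
    H.demazureWord p ε k n = 0 := by
  induction k generalizing ε n with
  | zero =>
    rw [demazureWord_zero]
    exact Pi.single_eq_of_ne (by omega) _
  | succ k ih =>
    rw [demazureWord_succ, dihedralDemazure_apply, ih _ n (by omega), ih, sub_zero, zero_div]
    obtain rfl | rfl := Int.units_eq_one_or ε <;> push_cast <;> omega

/-- The operator of `s_ε` compares the values at `ε(k + 1)` and `-εk`. The first lies outside the
support of the shorter word and the second is its extreme point, so nothing can cancel. -/
theorem demazureWord_apply_ne_zero (k : ℕ) (ε : ℤˣ) : H.demazureWord p ε k (ε * k) ≠ 0 := by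
  induction k generalizing ε with
  | zero =>
    rw [demazureWord_zero, Nat.cast_zero, mul_zero]
    have : (Pi.single 0 1 : ℤ → FractionRing (SymmetricAlgebra K V)) 0 = 1 := Pi.single_eq_same _ _
    exact this.symm ▸ one_ne_zero
  | succ k ih =>
    rw [demazureWord_succ, dihedralDemazure_apply, H.demazureWord_apply_eq_zero, zero_sub,
      show (ε : ℤ) - ε * (k + 1 : ℕ) = (-ε : ℤˣ) * k by push_cast; ring]
    · exact div_ne_zero (neg_ne_zero.2 (ih _)) (H.dihedralRoot_ne_zero p _ _)
    · obtain rfl | rfl := Int.units_eq_one_or ε <;> push_cast <;> omega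

/-- The homomorphism `R ⊗ R → R` sending `f ⊗ g` to `w⁻¹(f) g`, where `w` is the element number
`n` of the dihedral group. -/
def dihedralEval (n : ℤ) :
    SymmetricAlgebra K V ⊗[K] SymmetricAlgebra K V →ₐ[K] SymmetricAlgebra K V :=
  Algebra.TensorProduct.productMap (symAct H.ρ (dihedralElt cs p n)⁻¹) (AlgHom.id K _)

theorem dihedralEval_tmul (n : ℤ) (f g : SymmetricAlgebra K V) :
    H.dihedralEval p n (f ⊗ₜ g) = symAct H.ρ (dihedralElt cs p n)⁻¹ f * g := rfl

theorem dihedralBimod_act (z : (H.dihedralBimod p).carrier)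
    (a : SymmetricAlgebra K V ⊗[K] SymmetricAlgebra K V) (n : ℤ) :
    (H.dihedralBimod p).act z a n =
      algebraMap (SymmetricAlgebra K V) (FractionRing (SymmetricAlgebra K V))
        (H.dihedralEval p n a) * z n := by
  induction a with
  | zero => rw [map_zero, map_zero, map_zero, zero_mul]; rfl
  | add a b ha hb =>
    rw [map_add, map_add, map_add, add_mul, ← ha, ← hb]; rfl
  | tmul f g =>
    rw [Bimod.act_tmul, dihedralBimod_left, dihedralBimod_right, dihedralEval_tmul, map_mul,
      mul_assoc]

/-- The delta function is supported at `0`, where the dihedral element is trivial and the two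
actions agree. -/
theorem right_demazureWord_zero (ε : ℤˣ) (f : SymmetricAlgebra K V) :
    (H.dihedralBimod p).right f (H.demazureWord p ε 0) =
      (H.dihedralBimod p).left f (H.demazureWord p ε 0) := by
  refine funext fun n ↦ ?_
  rw [dihedralBimod_right, dihedralBimod_left]
  obtain rfl | hn := eq_or_ne n 0
  · rw [dihedralElt_zero, inv_one, map_one]; rfl
  · rw [H.demazureWord_apply_eq_zero p 0 ε n (by omega), mul_zero, mul_zero]

theorem demazure_ι (i : B) (v : V) : H.demazure i (SymmetricAlgebra.ι K V v) =
    algebraMap K (SymmetricAlgebra K V) (H.coroot i v) :=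
  H.demazureFun_eq i (by rw [symAct_simple_ι, Algebra.smul_def]; ring)

theorem dihedralDemazure_left_ι (ε : ℤˣ) (v : V) (z : (H.dihedralBimod p).carrier) :
    H.dihedralDemazure p ε ((H.dihedralBimod p).left (SymmetricAlgebra.ι K V v) z) =
      H.coroot (p ε) v • z + (H.dihedralBimod p).left
        (SymmetricAlgebra.ι K V (H.ρ (cs.simple (p ε)) v)) (H.dihedralDemazure p ε z) := by
  rw [dihedralDemazure_left, demazure_ι, symAct_ι, AlgHom.commutes]; rfl

theorem right_demazureWord_one (ε : ℤˣ) (v : V) :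
    (H.dihedralBimod p).right (SymmetricAlgebra.ι K V v) (H.demazureWord p ε 1) =
      H.coroot (p ε) v • H.demazureWord p ε 0 + (H.dihedralBimod p).left
        (SymmetricAlgebra.ι K V (H.ρ (cs.simple (p ε)) v)) (H.demazureWord p ε 1) := by
  rw [demazureWord_succ, ← dihedralDemazure_right, right_demazureWord_zero,
    dihedralDemazure_left_ι]
  rw [demazureWord_zero, demazureWord_zero]

/-- Moving `v` through the Demazure operators one at a time, the Leibniz rule produces one term for
each deleted letter. Deleting an interior letter puts two equal letters side by side and gives zero,
so only the deletions of the last and of the first letter survive, in this order. -/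
theorem right_demazureWord (ε : ℤˣ) (k : ℕ) (v : V) :
    (H.dihedralBimod p).right (SymmetricAlgebra.ι K V v) (H.demazureWord p ε (k + 2)) =
      H.coroot (p (ε * (-1) ^ (k + 1))) v • H.demazureWord p ε (k + 1) +
      H.coroot (p ε) (H.ρ (dihedralElt cs p (-ε * (k + 1))) v) • H.demazureWord p (-ε) (k + 1) +
      (H.dihedralBimod p).left (SymmetricAlgebra.ι K V
        (H.ρ (dihedralElt cs p (ε * (k + 2))) v)) (H.demazureWord p ε (k + 2)) := by
  induction k generalizing ε with
  | zero =>
    have h1 : H.ρ (cs.simple (p (-ε))) = H.ρ (dihedralElt cs p (-ε)) := by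
      have := simple_mul_dihedralElt cs p (-ε) 0
      rw [dihedralElt_zero, mul_one, sub_zero] at this
      rw [this]; push_cast; rfl
    have h2 : H.ρ (cs.simple (p ε)) (H.ρ (dihedralElt cs p (-ε)) v) =
        H.ρ (dihedralElt cs p (ε * 2)) v := by
      rw [← Module.End.mul_apply, ← map_mul, simple_mul_dihedralElt]
      congr 3; ring
    rw [H.demazureWord_succ p ε (0 + 1), ← dihedralDemazure_right, right_demazureWord_one, map_add,
      map_smul, dihedralDemazure_left_ι, h1, h2, ← add_assoc, ← demazureWord_succ]
    simp
  | succ k ih =>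
    have h2 : H.ρ (cs.simple (p ε)) (H.ρ (dihedralElt cs p (-ε * (k + 2))) v) =
        H.ρ (dihedralElt cs p (ε * (k + 3))) v := by
      rw [← Module.End.mul_apply, ← map_mul, simple_mul_dihedralElt]
      congr 3; ring
    -- This is the term in which the second letter is deleted, so that `s_ε` meets `s_ε`.
    have h3 : H.dihedralDemazure p ε (H.demazureWord p (- -ε) (k + 1)) = 0 := by
      rw [neg_neg, demazureWord_succ, dihedralDemazure_self]
    rw [H.demazureWord_succ p ε (k + 2), ← dihedralDemazure_right, ih, map_add, map_add, map_smul,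
      map_smul, dihedralDemazure_left_ι, h3]
    have e1 : -ε * (-1) ^ (k + 1) = ε * (-1) ^ (k + 1 + 1) := by rw [pow_succ _ (k + 1)]; simp
    rw [← demazureWord_succ, Units.val_neg, h2, smul_zero, add_zero, e1, add_assoc, Nat.cast_succ,
      show (k : ℤ) + 1 + 1 = k + 2 by ring, show (k : ℤ) + 1 + 2 = k + 3 by ring]
    exact (add_assoc _ _ _).symm

end Realization

namespace Realization

variable {B : Type*} {W : Type x} [Group W] {M : CoxeterMatrix B}
variable {cs : CoxeterSystem M W} {K : Type u} [CommRing K] {V : Type v} [AddCommGroup V]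
  [Module K V] (H : Realization cs K V) [IsDomain K] [Module.Free K V] (p : ℤˣ → B)

/-! ### The cyclic module generated by the function of the longest word. -/

section Generation

/-- The elements `a z`, where `a ∈ R ⊗ R` is of degree `d`. -/
def gen (z : (H.dihedralBimod p).carrier) (d : ℤ) : Submodule K (H.dihedralBimod p).carrier :=
  (tensorGrade (symGrade K V) d).map ((H.dihedralBimod p).act z)

variable {H p}

theorem self_mem_gen (z : (H.dihedralBimod p).carrier) : z ∈ H.gen p z 0 :=
  ⟨1, Submodule.subset_span ⟨0, 0, 1, one_mem_symGrade K V, 1, one_mem_symGrade K V, add_zero 0,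
    rfl⟩, Bimod.act_one _ _⟩

theorem left_mem_gen {z y : (H.dihedralBimod p).carrier} {i d k : ℤ} {f : SymmetricAlgebra K V}
    (hf : f ∈ symGrade K V i) (hy : y ∈ H.gen p z d) (hk : d + i = k) :
    (H.dihedralBimod p).left f y ∈ H.gen p z k := by
  obtain ⟨a, ha, rfl⟩ := hy
  exact ⟨_, tmul_mul_mem_tensorGrade (mul_mem_symGrade K V) hf (one_mem_symGrade K V) ha
    (by omega), Bimod.act_left _ _ _ _⟩

theorem right_mem_gen {z y : (H.dihedralBimod p).carrier} {i d k : ℤ} {f : SymmetricAlgebra K V}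
    (hf : f ∈ symGrade K V i) (hy : y ∈ H.gen p z d) (hk : d + i = k) :
    (H.dihedralBimod p).right f y ∈ H.gen p z k := by
  obtain ⟨a, ha, rfl⟩ := hy
  exact ⟨_, tmul_mul_mem_tensorGrade (mul_mem_symGrade K V) (one_mem_symGrade K V) hf ha
    (by omega), Bimod.act_right _ _ _ _⟩

/-- These are the reflections of the two coroots in `right_demazureWord`. If they were equal, the
elements number `ε(k + 2)` and `-εk` would coincide; the indices differ by `2ε(k + 1)`, so the order
of `s_1 s_{-1}` would divide `k + 1`. -/
theorem conj_ne_conj (ε : ℤˣ) {k : ℕ}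
    (hk : k + 1 < orderOf (cs.simple (p 1) * cs.simple (p (-1)))) :
    (dihedralElt cs p (-ε * (k + 1)))⁻¹ * cs.simple (p ε) * (dihedralElt cs p (-ε * (k + 1)))⁻¹⁻¹ ≠
      1 * cs.simple (p (ε * (-1) ^ (k + 1))) * 1⁻¹ := by
  rw [inv_inv, inv_one, one_mul, mul_one, mul_assoc, simple_mul_dihedralElt, ne_eq,
    inv_mul_eq_iff_eq_mul]
  have h : dihedralElt cs p (-ε * (k + 1)) * cs.simple (p (ε * (-1) ^ (k + 1))) =
      dihedralElt cs p (-ε * k) := by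
    obtain hk | hk := Nat.even_or_odd (k + 1)
    · have : Even (-(ε : ℤ) * (k + 1)) := (by exact_mod_cast hk : Even ((k : ℤ) + 1)).mul_left _
      rw [hk.neg_one_pow, mul_one, dihedralElt_mul_simple_of_even cs p ε this]
      congr 1; ring
    · have hε : Odd (-(ε : ℤ)) := by obtain rfl | rfl := Int.units_eq_one_or ε <;> simp
      have : Odd (-(ε : ℤ) * (k + 1)) := hε.mul (by exact_mod_cast hk : Odd ((k : ℤ) + 1))
      rw [hk.neg_one_pow, dihedralElt_mul_simple_of_odd cs p _ this]
      congr 1; push_cast; ring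
  rw [h, show (ε : ℤ) - -ε * (k + 1) = -ε * k + 2 * (ε * (k + 1)) by ring,
    dihedralElt_add_two_mul_eq_iff]
  intro hd
  have hd' : (orderOf (cs.simple (p 1) * cs.simple (p (-1))) : ℤ) ∣ ((k + 1 : ℕ) : ℤ) := by
    have := hd.mul_left (ε : ℤ)
    rw [← mul_assoc, ← Units.val_mul, Int.units_mul_self, Units.val_one, one_mul] at this
    exact_mod_cast this
  exact absurd (Nat.le_of_dvd (Nat.succ_pos k) (Int.natCast_dvd_natCast.1 hd')) (not_le.2 hk)

/-- Subtracting from the right action of `v` the left action of its transform removes the leading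
term of the Chevalley formula. What is left is a combination of the two shorter words, in degree two
higher, and `v` is free to be chosen. -/
theorem demazureWord_mem_gen_of_succ (hsep : H.Separated p) {z : (H.dihedralBimod p).carrier}
    {ε : ℤˣ} {k : ℕ} {d : ℤ} (hk : k < orderOf (cs.simple (p 1) * cs.simple (p (-1))))
    (h : H.demazureWord p ε (k + 1) ∈ H.gen p z d) (η : ℤˣ) :
    H.demazureWord p η k ∈ H.gen p z (d + 2) := by
  have hr (v : V) := right_mem_gen (ι_mem_symGrade K V v) h rfl
  have hl (v : V) := left_mem_gen (ι_mem_symGrade K V v) h rfl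
  cases k with
  | zero =>
    -- The empty word does not depend on a first letter, so there is a single term, and one `v` with
    -- coroot value `1` suffices.
    obtain ⟨v, hv⟩ := H.coroot_surjective (p ε) 1
    have := sub_mem (hr v) (hl (H.ρ (cs.simple (p ε)) v))
    rw [zero_add, right_demazureWord_one, hv, one_smul, add_sub_cancel_right] at this
    rw [demazureWord_zero] at this ⊢
    exact this
  | succ k =>
    have key (v : V) := sub_mem (hr v) (hl (H.ρ (dihedralElt cs p (ε * (k + 2))) v))
    simp only [right_demazureWord, add_sub_cancel_right] at key
    have hw := inv_mem (dihedralElt_mem_closure cs p (-ε * (k + 1)))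
    obtain rfl | rfl : η = ε ∨ η = -ε := by
      obtain rfl | rfl := Int.units_eq_one_or ε <;>
        obtain rfl | rfl := Int.units_eq_one_or η <;> simp
    -- To keep the word with the same first letter, `v` annihilates the coefficient of the other
    -- word. The second case exchanges the two roles.
    · obtain ⟨v, hv, hv'⟩ := hsep _ _ _ _ hw (one_mem _) (conj_ne_conj η hk)
      rw [inv_inv] at hv
      rw [inv_one, map_one, Module.End.one_apply] at hv'
      have := key v
      rwa [hv, hv', zero_smul, one_smul, add_zero] at this
    · obtain ⟨v, hv, hv'⟩ := hsep _ _ _ _ (one_mem _) hw (conj_ne_conj ε hk).symm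
      rw [inv_inv] at hv'
      rw [inv_one, map_one, Module.End.one_apply] at hv
      have := key v
      rwa [hv, hv', zero_smul, one_smul, zero_add] at this

theorem demazureWord_mem_gen (hsep : H.Separated p) {m : ℕ}
    (hm : m = orderOf (cs.simple (p 1) * cs.simple (p (-1)))) (ε₀ : ℤˣ) (j k : ℕ)
    (hjk : k + (j + 1) = m) (η : ℤˣ) :
    H.demazureWord p η k ∈ H.gen p (H.demazureWord p ε₀ m) (2 * (j + 1)) := by
  induction j generalizing k η with
  | zero =>
    subst hjk
    have := demazureWord_mem_gen_of_succ (k := k) hsep (by omega)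
      (self_mem_gen (H.demazureWord p ε₀ (k + (0 + 1)))) η
    simpa using this
  | succ j ih =>
    have := demazureWord_mem_gen_of_succ (k := k) hsep (by omega) (ih (k + 1) (by omega) η) η
    convert this using 2
    push_cast; ring

/-- For `k < m` the function of the word of length `k` starting with `η` is a multiple `a D` and is
nonzero at its extreme point `ηk`. The action is pointwise multiplication, so `D` is nonzero there
too. The point `m` is the extreme point of `D` itself. -/
theorem demazureWord_ne_zero (hsep : H.Separated p) {m : ℕ} (hm0 : m ≠ 0)
    (hm : m = orderOf (cs.simple (p 1) * cs.simple (p (-1)))) (n : ℤ) (h1 : -m < n) (h2 : n ≤ m) :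
    H.demazureWord p 1 m n ≠ 0 := by
  have key (η : ℤˣ) (k : ℕ) (hk : k < m) : H.demazureWord p 1 m (η * k) ≠ 0 := by
    obtain ⟨a, -, ha⟩ := demazureWord_mem_gen hsep hm 1 (m - k - 1) k (by omega) η
    have := H.demazureWord_apply_ne_zero p k η
    rw [← ha, dihedralBimod_act] at this
    exact right_ne_zero_of_mul this
  obtain rfl | hn := eq_or_ne n m
  · simpa using H.demazureWord_apply_ne_zero p m 1
  · obtain h | h := le_total 0 n
    · have := key 1 n.natAbs (by omega)
      rwa [Units.val_one, one_mul, Int.natCast_natAbs, abs_of_nonneg h] at this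
    · have := key (-1) n.natAbs (by omega)
      rwa [Units.val_neg, Units.val_one, neg_one_mul, Int.natCast_natAbs, abs_of_nonpos h,
        neg_neg] at this

/-- At the `2m` consecutive integers where `D` is nonzero, it can be cancelled in the field `Q`;
periodicity of the dihedral elements covers the other integers. -/
theorem dihedralEval_eq_zero (hsep : H.Separated p) {m : ℕ} (hm0 : m ≠ 0)
    (hm : m = orderOf (cs.simple (p 1) * cs.simple (p (-1))))
    {a : SymmetricAlgebra K V ⊗[K] SymmetricAlgebra K V}
    (ha : (H.dihedralBimod p).act (H.demazureWord p 1 m) a = 0) (n : ℤ) :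
    H.dihedralEval p n a = 0 := by
  have key (n : ℤ) (h1 : -m < n) (h2 : n ≤ m) : H.dihedralEval p n a = 0 := by
    have h := H.dihedralBimod_act p (H.demazureWord p 1 m) a n
    rw [ha] at h
    have h' := (mul_eq_zero.1 h.symm).resolve_right (demazureWord_ne_zero hsep hm0 hm n h1 h2)
    simpa using h'
  -- The remainder of `n + m - 1` modulo `2m` is shifted back by `m - 1`, which gives the
  -- representative of `n` in `-m < n ≤ m`.
  have hper (n' k : ℤ) : H.dihedralEval p (n' + 2 * (m * k)) = H.dihedralEval p n' := by
    rw [dihedralEval, (dihedralElt_add_two_mul_eq_iff cs p n' (m * k)).2 (by simp [hm])]; rfl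
  have h3 := Int.emod_add_mul_ediv (n + m - 1) (2 * m)
  have h4 := Int.emod_nonneg (n + m - 1) (b := 2 * m) (by omega)
  have h5 := Int.emod_lt_of_pos (n + m - 1) (b := 2 * m) (by omega)
  have h6 := hper ((n + m - 1) % (2 * m) - m + 1) ((n + m - 1) / (2 * m))
  rw [show (n + m - 1) % (2 * m) - m + 1 + 2 * (m * ((n + m - 1) / (2 * m))) = n by
    linear_combination h3] at h6
  rw [h6]
  exact key _ (by omega) (by omega)

end Generation

/-! ### The image of `B_x` in the functions on the integers. -/

section Words

/-- The homomorphism from `B_x` to the functions on the integers which is given by the Demazure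
operators. -/
def wordHom : (l : List ℤˣ) → (H.bsWord (l.map p)).toBimod.Hom (H.dihedralBimod p)
  | [] =>
    { toLin :=
        { toFun := fun f ↦ (H.dihedralBimod p).left f (H.demazureWord p 1 0)
          map_add' := fun f g ↦ by
            have h := map_add (H.dihedralBimod p).left f g
            exact LinearMap.congr_fun h (H.demazureWord p 1 0)
          map_smul' := fun k f ↦ by
            have h := map_smul (H.dihedralBimod p).left k f
            exact LinearMap.congr_fun h (H.demazureWord p 1 0) }
      map_left := fun f (g : SymmetricAlgebra K V) ↦ by
        have h := map_mul (H.dihedralBimod p).left f g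
        exact LinearMap.congr_fun h (H.demazureWord p 1 0)
      map_right := fun f (g : SymmetricAlgebra K V) ↦ by
        have h := map_mul (H.dihedralBimod p).left f g
        have h2 := LinearMap.congr_fun h (H.demazureWord p 1 0)
        have h3 : (H.dihedralBimod p).left f ((H.dihedralBimod p).left g (H.demazureWord p 1 0)) =
            (H.dihedralBimod p).right f ((H.dihedralBimod p).left g (H.demazureWord p 1 0)) := by
          rw [← (H.dihedralBimod p).left_right, right_demazureWord_zero, ← Module.End.mul_apply,
            ← map_mul, mul_comm, map_mul, Module.End.mul_apply]
        exact h2.trans h3 }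
  | ε :: l => (H.splitData (p ε)).liftHom (H.dihedralDemazure p ε)
      (H.dihedralDemazure_left_fixed p ε) (H.dihedralDemazure_right p ε) (wordHom l)

theorem wordHom_u (k : ℕ) (ε η : ℤˣ) (h : η = -ε) :
    (H.wordHom p (alternating ε η k)).toLin (H.u ((alternating ε η k).map p)) =
      H.demazureWord p ε k := by
  induction k generalizing ε η with
  | zero =>
    change (H.dihedralBimod p).left 1 (H.demazureWord p 1 0) = _
    rw [map_one, demazureWord_zero, demazureWord_zero]; rfl
  | succ k ih =>
    subst h
    have h := (H.splitData (p ε)).liftLin_tm (H.dihedralDemazure p ε)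
      (H.dihedralDemazure_left_fixed p ε) (H.wordHom p (alternating (-ε) ε k)) 1 1
      (H.u ((alternating (-ε) ε k).map p))
    rw [ih (-ε) ε (neg_neg ε).symm, map_one, Module.End.one_apply, Module.End.one_apply,
      ← demazureWord_succ] at h
    exact h

/-- The elements of degree `d` in the span of the functions obtained by Demazure operators from the
subwords of the alternating word of length `n` which starts with `ε`. -/
def demazureSpan (ε : ℤˣ) (n : ℕ) (d : ℤ) : Submodule K (H.dihedralBimod p).carrier :=
  Submodule.span K {z | ∃ (η : ℤˣ) (k : ℕ), (k < n ∨ k = n ∧ η = ε) ∧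
    ∃ h ∈ symGrade K V (d + 2 * k), z = (H.dihedralBimod p).left h (H.demazureWord p η k)}

variable {H p}

theorem left_mem_demazureSpan {ε : ℤˣ} {n : ℕ} {d i j : ℤ} {z : (H.dihedralBimod p).carrier}
    {f : SymmetricAlgebra K V} (hf : f ∈ symGrade K V i) (hz : z ∈ H.demazureSpan p ε n d)
    (hj : d + i = j) : (H.dihedralBimod p).left f z ∈ H.demazureSpan p ε n j := by
  have : H.demazureSpan p ε n d ≤
      (H.demazureSpan p ε n j).comap ((H.dihedralBimod p).left f) := by
    refine Submodule.span_le.2 ?_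
    rintro z ⟨η, k, hk, h, hh, rfl⟩
    have := mul_mem_symGrade K V _ _ _ hf _ hh
    rw [show i + (d + 2 * k) = j + 2 * k by omega] at this
    refine Submodule.subset_span ⟨η, k, hk, f * h, this, ?_⟩
    rw [map_mul]; rfl
  exact this hz

/-- By the Leibniz rule, the new operator either differentiates the coefficient or twists it and
acts on the word. In the second case it prolongs an alternating word or gives zero, since its square
is zero; no other words arise. -/
theorem dihedralDemazure_mem_demazureSpan {ε : ℤˣ} {n : ℕ} {d j : ℤ}
    {z : (H.dihedralBimod p).carrier} (hz : z ∈ H.demazureSpan p (-ε) n d) (hj : d = j + 2) :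
    H.dihedralDemazure p ε z ∈ H.demazureSpan p ε (n + 1) j := by
  have : H.demazureSpan p (-ε) n d ≤
      (H.demazureSpan p ε (n + 1) j).comap (H.dihedralDemazure p ε) := by
    refine Submodule.span_le.2 ?_
    rintro z ⟨η, k, hk, h, hh, rfl⟩
    have hs : (H.dihedralBimod p).left (symAct H.ρ (cs.simple (p ε)) h)
        (H.demazureWord p ε (k + 1)) ∈ H.demazureSpan p ε (n + 1) j := by
      refine Submodule.subset_span ⟨ε, k + 1, hk.imp Nat.succ_lt_succ
        (fun h ↦ ⟨congrArg _ h.1, rfl⟩), _, ?_, rfl⟩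
      have := H.symAct_mem (cs.simple (p ε)) _ h hh
      rwa [show d + 2 * k = j + 2 * (k + 1 : ℕ) by push_cast; omega] at this
    change H.dihedralDemazure p ε _ ∈ H.demazureSpan p ε (n + 1) j
    rw [dihedralDemazure_left]
    refine add_mem (Submodule.subset_span ⟨η, k, Or.inl (hk.elim (·.trans n.lt_succ_self)
      fun h ↦ h.1 ▸ n.lt_succ_self), _, ?_, rfl⟩) ?_
    · have := H.demazure_grade (p ε) _ h hh
      rwa [show d + 2 * k - 2 = j + 2 * k by omega] at this
    · rw [demazureWord_succ] at hs
      obtain rfl | rfl : η = -ε ∨ η = ε := by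
        obtain rfl | rfl := Int.units_eq_one_or ε <;>
          obtain rfl | rfl := Int.units_eq_one_or η <;> simp
      · exact hs
      -- If the word already starts with `ε` the result is zero, except for the empty word: its
      -- label `η` carries no information, and it is prolonged to the word `s_ε`.
      · cases k with
        | zero => rwa [demazureWord_zero] at hs ⊢
        | succ k =>
          rw [demazureWord_succ, dihedralDemazure_self, map_zero]
          exact zero_mem _
  exact this hz

/-- The two coordinates of `b` in `B_s ⊗ M` have degrees `i + 1` and `i - 1`. A Demazure operator
lowers the degree by `2`, and multiplication by `δ` restores it for the second coordinate, so each
letter costs one degree. -/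
theorem wordHom_mem_demazureSpan (k : ℕ) (ε η : ℤˣ) (h : η = -ε) (i : ℤ)
    (b : (H.bsWord ((alternating ε η k).map p)).carrier)
    (hb : b ∈ (H.bsWord ((alternating ε η k).map p)).grade i) :
    (H.wordHom p (alternating ε η k)).toLin b ∈ H.demazureSpan p ε k (i - k) := by
  induction k generalizing ε η i with
  | zero =>
    have h0 : i - (0 : ℕ) + 2 * (0 : ℕ) = i := by push_cast; ring
    have hb' : b ∈ symGrade K V (i - (0 : ℕ) + 2 * (0 : ℕ)) := h0.symm ▸ hb
    refine Submodule.subset_span ⟨ε, 0, Or.inr ⟨rfl, rfl⟩, b, hb', ?_⟩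
    rw [demazureWord_zero, ← H.demazureWord_zero p 1]
    rfl
  | succ k ih =>
    subst h
    have hM := H.bsWord_isC ((alternating (-ε) ε k).map p)
    have hb' := ((H.splitData (p ε)).tensor_grade _ hM.toIsCPrime (mul_mem_symGrade K V)
      (one_mem_symGrade K V) i).le hb
    obtain ⟨h1, h2⟩ := hb'
    have h1' := ih (-ε) ε (neg_neg ε).symm _ _ h1
    have h2' := ih (-ε) ε (neg_neg ε).symm _ _ h2
    refine add_mem (dihedralDemazure_mem_demazureSpan h1' (by push_cast; ring))
      (left_mem_demazureSpan (H.splitData (p ε)).δ_mem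
        (dihedralDemazure_mem_demazureSpan h2' (j := i - 1 - k - 2) (by ring)) ?_)
    push_cast; ring

/-- If the delta function has degree `0`, a word of length `k` has degree `-2k`. The shift by `2m`
is therefore the degree of the coefficient relative to `D`. -/
theorem demazureSpan_le_gen (hsep : H.Separated p) {m : ℕ}
    (hm : m = orderOf (cs.simple (p 1) * cs.simple (p (-1)))) (d : ℤ) :
    H.demazureSpan p 1 m d ≤ H.gen p (H.demazureWord p 1 m) (d + 2 * m) := by
  refine Submodule.span_le.2 ?_
  rintro z ⟨η, k, hk, h, hh, rfl⟩
  obtain hk | ⟨rfl, rfl⟩ := hk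
  · refine left_mem_gen hh (demazureWord_mem_gen hsep hm 1 (m - k - 1) k (by omega) η) ?_
    omega
  · exact left_mem_gen hh (self_mem_gen _) (by ring)

end Words

end Realization

/-! ### Elements of `R ⊗ R` that annihilate `u_y`, and the support of `B_y`. -/

namespace SplitData

variable {K : Type u} [CommRing K] {R : Type w} [CommRing R] [Algebra K R]
variable {W : Type x} [Group W] {σ : W →* (R →ₐ[K] R)} {𝒢 : ℤ → Submodule K R} {s : W}

/-- The right factor of `a` acts on `M` alone, so a coordinate of `B_s` affects only the left
factor. This reduces the action on `u_y` to shorter words. -/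
theorem coord_act (M : DecBimod K R W) (c : R →ₗ[fixed (σ s)] R) (m : M.carrier) (a : R ⊗[K] R) :
    coord (𝒢 := 𝒢) M c (((Bs σ 𝒢 s).tensor M).toBimod.act (tm M 1 1 m) a) =
      M.toBimod.act m ((c.restrictScalars K).rTensor R a) := by
  induction a with
  | zero =>
    rw [map_zero, map_zero, map_zero]; exact map_zero (coord M c)
  | add a b ha hb =>
    rw [map_add, map_add, map_add, ← ha, ← hb]
    exact map_add (coord M c) _ _
  | tmul f g =>
    have h : ((Bs σ 𝒢 s).tensor M).left f (((Bs σ 𝒢 s).tensor M).right g (tm M 1 1 m)) =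
        tm M (f * 1) 1 (M.rightMul g m) :=
      congrArg (fun b ↦ tn M b (M.rightMul g m)) (left_bt f 1 1)
    refine (congrArg (coord M c) h).trans ((coord_tm M c _ _ _).trans ?_)
    rw [mul_one, mul_one]
    rfl

end SplitData

namespace Realization

variable {B : Type*} {W : Type x} [Group W] {M : CoxeterMatrix B}
variable {cs : CoxeterSystem M W} {K : Type u} [CommRing K] {V : Type v} [AddCommGroup V]
  [Module K V] (H : Realization cs K V) [IsDomain K] [Module.Free K V] (p : ℤˣ → B)

theorem u_mem_grade : ∀ l : List B, H.u l ∈ (H.bsWord l).grade (-l.length)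
  | [] => one_mem_symGrade K V
  | i :: l => by
    have h1 : SplitData.bt 1 1 ∈ (H.bs i).grade (-1) :=
      SplitData.bt_mem_grade (one_mem_symGrade K V) (one_mem_symGrade K V) (by ring)
    exact (H.bs i).tensor_mem_grade (H.bsWord l) h1 (u_mem_grade l)
      (by rw [List.length_cons]; push_cast; ring)

theorem dihedralEval_demazure (ε : ℤˣ) (n : ℤ)
    (a : SymmetricAlgebra K V ⊗[K] SymmetricAlgebra K V) :
    H.dihedralRoot p ε n * algebraMap (SymmetricAlgebra K V) _
      (H.dihedralEval p n (((H.demazure (p ε)).restrictScalars K).rTensor _ a)) =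
    algebraMap (SymmetricAlgebra K V) _ (H.dihedralEval p n a) -
      algebraMap (SymmetricAlgebra K V) _ (H.dihedralEval p (ε - n) a) := by
  induction a with
  | zero => simp
  | add a b ha hb => simp only [map_add, mul_add, ha, hb]; ring
  | tmul f g =>
    have := H.dihedralRoot_mul_demazure p ε n f
    rw [LinearMap.rTensor_tmul, dihedralEval_tmul, dihedralEval_tmul, dihedralEval_tmul, map_mul,
      map_mul, map_mul, ← sub_mul, ← this]
    exact (mul_assoc _ _ _).symm

theorem dihedralEval_splitData_c (ε : ℤˣ) (n : ℤ)
    (a : SymmetricAlgebra K V ⊗[K] SymmetricAlgebra K V) :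
    H.dihedralEval p n (((H.splitData (p ε)).c.restrictScalars K).rTensor _ a) =
      H.dihedralEval p n a - symAct H.ρ (dihedralElt cs p n)⁻¹ (H.splitData (p ε)).δ *
        H.dihedralEval p n (((H.splitData (p ε)).d.restrictScalars K).rTensor _ a) := by
  induction a with
  | zero => simp
  | add a b ha hb => simp only [map_add, mul_add, ha, hb]; ring
  | tmul f g =>
    have h : symAct H.ρ (dihedralElt cs p n)⁻¹ f = _ :=
      congrArg (symAct H.ρ (dihedralElt cs p n)⁻¹) ((H.splitData (p ε)).eq_add f)
    rw [map_add, map_mul] at h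
    rw [LinearMap.rTensor_tmul, LinearMap.rTensor_tmul, dihedralEval_tmul, dihedralEval_tmul,
      dihedralEval_tmul, h, LinearMap.restrictScalars_apply, LinearMap.restrictScalars_apply]
    ring

/-- The induction removes the first letter: the coordinates of `a u` are `(c ⊗ 1)(a)` and `(d ⊗
1)(a)` acting on the shorter `u`. As `d` is the Demazure operator, evaluating `(d ⊗ 1)(a)` at `n`
gives a divided difference of the evaluations of `a` at `n` and `ε - n`, so it vanishes; then so
does the evaluation of `(c ⊗ 1)(a)`. For the empty word, evaluation at `0` is the action itself. -/
theorem act_u_eq_zero : ∀ (l : List ℤˣ) (a : SymmetricAlgebra K V ⊗[K] SymmetricAlgebra K V),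
    (∀ n, H.dihedralEval p n a = 0) →
      (H.bsWord (l.map p)).toBimod.act (H.u (l.map p)) a = 0
  | [], a, ha => by
    have h : (H.bsWord []).toBimod.act (H.u []) a = H.dihedralEval p 0 a := by
      clear ha
      induction a with
      | zero => rw [map_zero, map_zero]; rfl
      | add a b ha hb => rw [map_add, map_add, ha, hb]; rfl
      | tmul f g =>
        rw [dihedralEval_tmul, dihedralElt_zero, inv_one, map_one]
        exact congrArg (f * ·) (mul_one g)
    exact h.trans (ha 0)
  | ε :: l, a, ha => by
    have hd (n : ℤ) : H.dihedralEval p n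
        (((H.splitData (p ε)).d.restrictScalars K).rTensor _ a) = 0 := by
      have := H.dihedralEval_demazure p ε n a
      rw [ha, ha, sub_self] at this
      have := (mul_eq_zero.1 this).resolve_left (H.dihedralRoot_ne_zero p ε n)
      exact (FaithfulSMul.algebraMap_eq_zero_iff _ _).1 this
    have hc (n : ℤ) : H.dihedralEval p n
        (((H.splitData (p ε)).c.restrictScalars K).rTensor _ a) = 0 := by
      rw [dihedralEval_splitData_c, hd, ha, mul_zero, sub_zero]
    have h (c : SymmetricAlgebra K V →ₗ[fixed (symAct H.ρ (cs.simple (p ε)))] SymmetricAlgebra K V) :=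
      SplitData.coord_act (𝒢 := symGrade K V) (H.bsWord (l.map p)) c (H.u (l.map p)) a
    refine ((H.splitData (p ε)).equiv (H.bsWord (l.map p))).injective ?_
    refine (Prod.ext ((h _).trans (act_u_eq_zero l _ hc)) ((h _).trans (act_u_eq_zero l _ hd)) :
      _ = ((0, 0) : (H.bsWord (l.map p)).Right × (H.bsWord (l.map p)).Right)).trans ?_
    exact (map_zero _).symm

/-- The summand of `B_s ⊗ M` at `g` is made up of those of `M` at `g` and `s⁻¹ g`, and left
multiplication by `s` preserves the dihedral group. -/
theorem stalk_eq_bot {g : W} : ∀ l : List ℤˣ, (∀ n, g ≠ dihedralElt cs p n) →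
    (H.bsWord (l.map p)).stalk g = ⊥ := by
  intro l
  induction l generalizing g with
  | nil => exact fun hg ↦ iSup_neg (dihedralElt_zero cs p ▸ hg 0)
  | cons ε l ih =>
    intro hg
    have h2 : ∀ n, (cs.simple (p ε))⁻¹ * g ≠ dihedralElt cs p n := fun n h ↦ by
      rw [inv_mul_eq_iff_eq_mul, simple_mul_dihedralElt] at h
      exact hg _ h
    have hM := (H.bsWord_isC (l.map p)).toIsCPrime
    have h3 := (H.splitData (p ε)).tensor_stalk _ hM g
    rw [ih hg, ih h2, Submodule.prod_bot] at h3
    exact h3.trans (LinearMap.ker_eq_bot.2 ((H.splitData (p ε)).psi _ hM).injective)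

/-! ### Compatibility with the decompositions and construction of the morphism. -/

variable {H p}

theorem Separated.exists_symAct_ne (h : H.Separated p) {a b : ℤ}
    (hab : dihedralElt cs p a ≠ dihedralElt cs p b) :
    ∃ f, symAct H.ρ (dihedralElt cs p a) f ≠ symAct H.ρ (dihedralElt cs p b) f := by
  obtain ⟨v, hv⟩ := h.exists_ρ_ne hab
  refine ⟨SymmetricAlgebra.ι K V v, fun h ↦ ι_ne_zero (K := K) (sub_ne_zero.2 hv) ?_⟩
  rw [map_sub, ← symAct_ι, ← symAct_ι, h, sub_self]

/-- A bimodule map preserves eigenspaces. The target is supported on the dihedral group, whose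
elements act on `R` by distinct automorphisms, so its eigenspace at such an element lies in the
corresponding summand. Outside the group the source summand is zero. -/
theorem Separated.onLoc_mem_stalk (h : H.Separated p) (l l' : List ℤˣ)
    (φ : (H.bsWord (l.map p)).toBimod.Hom (H.bsWord (l'.map p)).toBimod) (g : W)
    (z : (H.bsWord (l.map p)).loc) (hz : z ∈ (H.bsWord (l.map p)).stalk g) :
    φ.onLoc z ∈ (H.bsWord (l'.map p)).stalk g := by
  by_cases hg : ∀ n, g ≠ dihedralElt cs p n
  · rw [H.stalk_eq_bot p l hg, Submodule.mem_bot] at hz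
    rw [hz, map_zero]
    exact zero_mem _
  push Not at hg
  obtain ⟨b, rfl⟩ := hg
  refine (H.bsWord_isC (l'.map p)).mem_stalk_of_eigen (fun g hg hne ↦ ?_)
    (φ.onLoc_mem_eigen fun f ↦ (H.bsWord_isC (l.map p)).stalk_smul _ f z hz)
  obtain ⟨a, rfl⟩ : ∃ a, g = dihedralElt cs p a := by
    by_contra hg'
    push Not at hg'
    exact hg (H.stalk_eq_bot p l' hg')
  exact h.exists_symAct_ne hne

theorem length_map_alternating (ε η : ℤˣ) (k : ℕ) : ((alternating ε η k).map p).length = k := by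
  induction k generalizing ε η with
  | zero => rfl
  | succ k ih => exact congrArg (· + 1) (ih η ε)

theorem map_alternating (ε η : ℤˣ) (k : ℕ) :
    (alternating ε η k).map p = alternating (p ε) (p η) k := by
  induction k generalizing ε η with
  | zero => rfl
  | succ k ih => exact congrArg (p ε :: ·) (ih η ε)

theorem Separated.exists_hom (h : H.Separated p) {m : ℕ} (hm0 : m ≠ 0)
    (hm : m = orderOf (cs.simple (p 1) * cs.simple (p (-1)))) :
    ∃ φ : (H.bsWord ((alternating 1 (-1) m).map p)).Hom
        (H.bsWord ((alternating (-1) 1 m).map p)),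
      φ.toLin (H.u ((alternating 1 (-1) m).map p)) = H.u ((alternating (-1) 1 m).map p) := by
  set l : List ℤˣ := alternating 1 (-1) m with hl
  set l' : List ℤˣ := alternating (-1) 1 m with hl'
  -- The homogeneous form, with `a` of degree `i + m`, is needed below: since `u_y` has degree `-m`,
  -- the element `a u_y` has degree `i` again.
  have hgen (i : ℤ) (b) (hb : b ∈ (H.bsWord (l.map p)).grade i) :
      (H.wordHom p l).toLin b ∈ H.gen p (H.demazureWord p 1 m) (i + m) := by
    have := demazureSpan_le_gen h hm _ (wordHom_mem_demazureSpan m 1 (-1) rfl i b hb)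
    rwa [show i - m + 2 * m = i + m by ring] at this
  have hrange (b) : (H.wordHom p l).toLin b ∈
      LinearMap.range ((H.dihedralBimod p).act (H.demazureWord p 1 m)) := by
    have : (⊤ : Submodule K (H.bsWord (l.map p)).carrier) ≤
        (LinearMap.range ((H.dihedralBimod p).act (H.demazureWord p 1 m))).comap
          (H.wordHom p l).toLin := by
      rw [← (H.bsWord_isC (l.map p)).grade_iSup]
      exact iSup_le fun i b hb ↦ LinearMap.map_le_range (hgen i b hb)
    exact this Submodule.mem_top
  obtain ⟨φ, hφ⟩ := Bimod.exists_hom_of_act (M' := (H.bsWord (l'.map p)).toBimod) (H.wordHom p l)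
    (H.demazureWord p 1 m) (H.u (l'.map p)) hrange
    (fun a ha ↦ H.act_u_eq_zero p l' a (dihedralEval_eq_zero h hm0 hm ha))
  refine ⟨{ toHom := φ
            map_grade := fun i b hb ↦ ?_
            map_stalk := h.onLoc_mem_stalk l l' φ }, ?_⟩
  · obtain ⟨a, ha, hab⟩ := hgen i b hb
    rw [hφ b a hab]
    have := act_mem_grade (H.bsWord_isC (l'.map p)).toIsCPrime (H.u_mem_grade (l'.map p)) ha
    rwa [hl', length_map_alternating, add_neg_cancel_right] at this
  -- The image of `u_x` is `D` itself, so `a = 1` computes its value.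
  · refine (hφ _ 1 ?_).trans (Bimod.act_one _ _)
    rw [Bimod.act_one, hl, H.wordHom_u p m 1 (-1) rfl]

end Realization

end

end Soergel

theorem mainTheorem11 {B : Type*} [Finite B] {W : Type*} [Group W] {M : CoxeterMatrix B}
    (cs : CoxeterSystem M W)
    {K : Type*} [CommRing K] [IsDomain K] [IsNoetherianRing K]
    {V : Type*} [AddCommGroup V] [Module K V] [Module.Free K V] [Module.Finite K V]
    (H : Soergel.Realization cs K V)
    (c : W → W × B)
    (hc : ∀ t, cs.IsReflection t → t = (c t).1 * cs.simple (c t).2 * (c t).1⁻¹)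
    (h : ∀ i j : B, IsOfFinOrder (cs.simple i * cs.simple j) →
      ∀ t₁ t₂ : W, cs.IsReflection t₁ → cs.IsReflection t₂ →
        t₁ ∈ Subgroup.closure {cs.simple i, cs.simple j} →
        t₂ ∈ Subgroup.closure {cs.simple i, cs.simple j} → t₁ ≠ t₂ →
        ∃ v : V, H.reflectionCoroot c t₁ v = 0 ∧ H.reflectionCoroot c t₂ v = 1) :
    ∀ i j : B, cs.simple i ≠ cs.simple j → IsOfFinOrder (cs.simple i * cs.simple j) →
      ∃ φ : H.BS (Soergel.alternating i j (orderOf (cs.simple i * cs.simple j))) ⟶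
          H.BS (Soergel.alternating j i (orderOf (cs.simple i * cs.simple j))),
        Soergel.ObjC.toLin φ
            (H.u (Soergel.alternating i j (orderOf (cs.simple i * cs.simple j)))) =
          H.u (Soergel.alternating j i (orderOf (cs.simple i * cs.simple j))) := by
  intro i j _ hfin
  -- Indexing the two generators by signs lets one induction handle the alternating words of both
  -- kinds.
  obtain ⟨p, rfl, rfl⟩ : ∃ p : ℤˣ → B, p 1 = i ∧ p (-1) = j :=
    ⟨fun ε ↦ if ε = 1 then i else j, if_pos rfl, if_neg (by decide)⟩
  have hsep : H.Separated p := H.separated_of_reflectionCoroot p c hc (h _ _ hfin)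
  -- Finite order excludes the default value `0` of `orderOf`.
  have hhom := hsep.exists_hom (orderOf_pos_iff.2 hfin).ne' rfl
  rw [Soergel.Realization.map_alternating, Soergel.Realization.map_alternating] at hhom
  exact hhom
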